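/- Let $a,b,c>0$. In the plane put $\mathcal D=\{x=a,\ 0<y<b\}$, $\mathcal A_0=\mathcal D\cup\{0<x<a\}$, $\mathcal B_0=\mathcal D\cup\{x>a\}$, $\mathcal A_1=\mathcal A_0\cap\{y>0\}$, $\mathcal B_1=\mathcal B_0\cap\{y>0\}$, $\mathcal B_2=\mathcal B_0\cap\{y<b\}$, $\mathcal B_3=\mathcal B_0\cap\{0<y<b\}$. For $i\in\{0,1\}$ and $j\in\{0,1,2,3\}$ let $\mathcal C_{ij}=\mathcal A_i\cup\mathcal B_j$ and $\mathcal S_{ij}=\mathcal C_{ij}\times(0,c)\subset\mathbb R^3$. A movement of an open rectangle $R$ around the corner in $\mathcal C_{ij}$ is a continuous path $(\Phi_t)_{t\in[0,1]}$ of rigid motions of the plane with $\Phi_0(R)\subset\mathcal A_i$, $\Phi_1(R)\subset\mathcal B_j$ and $\Phi_t(R)\subset\mathcal C_{ij}$ for all $t\in[0,1]$; a movement of an open rectangular parallelepiped $P$ around the corner in $\mathcal S_{ij}$ is defined in the same way, with rigid motions of space and with $\mathcal A_i\times(0,c)$, $\mathcal B_j\times(0,c)$, $\mathcal S_{ij}$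 in place of $\mathcal A_i$, $\mathcal B_j$, $\mathcal C_{ij}$. Let $\mathcal R_{ij}$ be the set of open rectangles that have a movement around the corner in $\mathcal C_{ij}$, and let $\mathcal P_{ij}$ be the set of those open rectangular parallelepipeds that have maximal volume among all the ones having a movement around the corner in $\mathcal S_{ij}$. Then $\mathcal P_{ij}$ is nonempty, and every $P\in\mathcal P_{ij}$ has volume $abc$. Moreover, for every $P\in\mathcal P_{ij}$, every movement $(\Phi_t)$ of $P$ around the corner in $\mathcal S_{ij}$ and every $t\in[0,1]$, one has $\Phi_t(P)=R\times(0,c)$ for a rectangle $R\in\mathcal R_{ij}$ whose area is maximal among the rectangles in $\mathcal R_{ij}$. In particular, if $P$ lies in its starting position, that is, if $\Phi_0$ is the identity for some such movement, then $P=R\times(0,c)$ with such an $R$. -/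

import Mathlib

open MeasureTheory Set

/-- Euclidean `n`-space. -/
abbrev Euc (n : ℕ) : Type := EuclideanSpace ℝ (Fin n)

/-- The Euclidean group `E(n)` of rigid motions of Euclidean `n`-space. -/
abbrev EucGroup (n : ℕ) : Type := Euc n ≃ᵃⁱ[ℝ] Euc n

/-- Open nondegenerate rectangular boxes in arbitrary position: open rectangles for `n = 2`, open
rectangular parallelepipeds for `n = 3`. The numbers `s k` are the side lengths. -/
def IsOpenBox {n : ℕ} (S : Set (Euc n)) : Prop :=
  ∃ s : Fin n → ℝ, (∀ k, 0 < s k) ∧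
    ∃ g : EucGroup n, S = g '' {x : Euc n | ∀ k, 0 < x k ∧ x k < s k}

/-- `Φ` is a continuous path of rigid motions that carries `S` from inside `A` to inside `B`,
staying inside `A ∪ B` all the time. Continuity in the Euclidean group is pointwise convergence,
which is its usual topology. -/
def IsMovement {n : ℕ} (A B S : Set (Euc n)) (Φ : unitInterval → EucGroup n) : Prop :=
  (∀ x : Euc n, Continuous fun t => Φ t x) ∧
    Φ 0 '' S ⊆ A ∧ Φ 1 '' S ⊆ B ∧ ∀ t, Φ t '' S ⊆ A ∪ B

/-- The open boxes that can be moved from `A` to `B` inside `A ∪ B`. -/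
def movableBoxes {n : ℕ} (A B : Set (Euc n)) : Set (Set (Euc n)) :=
  {S | IsOpenBox S ∧ ∃ Φ : unitInterval → EucGroup n, IsMovement A B S Φ}

/-- The members of a family of sets whose volume (area, for `n = 2`) is maximal in the family. -/
def maxVolume {n : ℕ} (F : Set (Set (Euc n))) : Set (Set (Euc n)) :=
  {S | S ∈ F ∧ ∀ T ∈ F, volume T ≤ volume S}

/-- The door `{x = a, 0 < y < b}` between the two arms of the corridors. -/
def door (a b : ℝ) : Set (Euc 2) := {p | p 0 = a ∧ 0 < p 1 ∧ p 1 < b}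

/-- The first arms `A₀`, `A₁`. -/
def armA (a b : ℝ) : Fin 2 → Set (Euc 2)
  | 0 => door a b ∪ {p | 0 < p 0 ∧ p 0 < a}
  | 1 => (door a b ∪ {p | 0 < p 0 ∧ p 0 < a}) ∩ {p | 0 < p 1}

/-- The second arms `B₀`, `B₁`, `B₂`, `B₃`. -/
def armB (a b : ℝ) : Fin 4 → Set (Euc 2)
  | 0 => door a b ∪ {p | a < p 0}
  | 1 => (door a b ∪ {p | a < p 0}) ∩ {p | 0 < p 1}
  | 2 => (door a b ∪ {p | a < p 0}) ∩ {p | p 1 < b}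
  | 3 => (door a b ∪ {p | a < p 0}) ∩ {p | 0 < p 1 ∧ p 1 < b}

/-- The right cylinder `S × (0, c)` in space over a set `S` in the plane. -/
def cyl (S : Set (Euc 2)) (c : ℝ) : Set (Euc 3) :=
  {p | !₂[p 0, p 1] ∈ S ∧ 0 < p 2 ∧ p 2 < c}

/-- `R_ij`: the open rectangles that can move around the corner in `C_ij = A_i ∪ B_j`. -/
def movableRectangles (a b : ℝ) (i : Fin 2) (j : Fin 4) : Set (Set (Euc 2)) :=
  movableBoxes (armA a b i) (armB a b j)

/-- `P_ij`: the open rectangular parallelepipeds of maximal volume among those that can move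
around the corner in `S_ij = C_ij × (0, c) = A_i × (0, c) ∪ B_j × (0, c)`. -/
def maxParallelepipeds (a b c : ℝ) (i : Fin 2) (j : Fin 4) : Set (Set (Euc 3)) :=
  maxVolume (movableBoxes (cyl (armA a b i) c) (cyl (armB a b j) c))

/-! Let `n`, `p`, `m` be the rows of the orientation matrix and `s` the side lengths. Call the box
narrow if `∑ k, s k * |p k - l * n k| ≤ b` for some `l`. By linear programming duality
(`exists_l1_dual`), this means that its central slice parallel to the door plane has width at most
`b` in the second coordinate direction. So the box is narrow when its centre crosses the door plane,
and there is a first narrow time. Until then the slice by the door plane contains no translate of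
the central slice, so the box lies so far inside the first arm that `s k * |n k| ≤ a` for every `k`
(`DoorPassage.exists_first_narrow`). The volume is the absolute determinant of the rows `s * n`, `s
* (p - l * n)`, `s * m`. It is at most the sup norm of the first row times the `ℓ¹` norms of the
others, hence at most `a * b * c`.

In case of equality all defects in this estimate vanish (`support_of_det_bound`). Either an edge of
length `c` is vertical, and then it stays so throughout, by connectedness of the time interval; or
the box has an exceptional orientation with an edge of length `b` along the second axis. The latter
is excluded because slightly earlier orientations would already be narrow
(`abs_middle_eq_one_of_near`). With vertical edges filling the slab, the motion is a plane motion
times the interval. The base has area `a * b`, and the same volume bound applied to prisms shows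
that no movable rectangle has a larger area. -/

/-! ### Linear forms on boxes and widths of slices -/

/-- The supremum of a linear form over a centred open box. -/
theorem add_half_sum_le_of_forall_box {ι : Type*} [Fintype ι] {s n : ι → ℝ} (hs : ∀ k, 0 < s k)
    {α β : ℝ} (h : ∀ x : ι → ℝ, (∀ k, |x k| < s k / 2) → α + ∑ k, n k * x k ≤ β) :
    α + (∑ k, s k * |n k|) / 2 ≤ β := by
  -- The form is maximal at a vertex outside the open box; test the vertex shrunk by `r` and let `r`
  -- tend to `1`.
  have key : ∀ r ∈ Ico (0 : ℝ) 1, α + r * ((∑ k, s k * |n k|) / 2) ≤ β := by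
    intro r hr
    have h1 := h (fun k => r * (s k / 2) * SignType.sign (n k)) (fun k => by
      have h2 : |((SignType.sign (n k) : SignType) : ℝ)| ≤ 1 := by
        rcases lt_trichotomy (n k) 0 with h | h | h <;> simp [h]
      have h3 : 0 ≤ r * (s k / 2) := mul_nonneg hr.1 (by linarith [hs k])
      rw [abs_mul, abs_of_nonneg h3]
      nlinarith [hs k, hr.2])
    convert h1 using 2
    rw [Finset.sum_div, Finset.mul_sum]
    refine Finset.sum_congr rfl fun k _ => ?_
    rw [← self_mul_sign (n k)]
    ring
  have hT : Filter.Tendsto (fun r : ℝ => α + r * ((∑ k, s k * |n k|) / 2)) (nhdsWithin 1 (Iio 1))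
      (nhds (α + 1 * ((∑ k, s k * |n k|) / 2))) :=
    (Continuous.tendsto (by fun_prop) _).mono_left nhdsWithin_le_nhds
  rw [one_mul] at hT
  refine le_of_tendsto hT ?_
  filter_upwards [Ico_mem_nhdsLT (zero_lt_one' ℝ)] with r hr using key r hr

theorem half_sum_le_of_forall_box {ι : Type*} [Fintype ι] {s n : ι → ℝ} (hs : ∀ k, 0 < s k)
    {α β : ℝ} (h : ∀ x : ι → ℝ, (∀ k, |x k| < s k / 2) → β ≤ α + ∑ k, n k * x k) :
    β ≤ α - (∑ k, s k * |n k|) / 2 := by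
  have := add_half_sum_le_of_forall_box (n := fun k => - n k) (α := -α) (β := -β) hs (fun x hx => by
    have := h x hx
    simp only [neg_mul, Finset.sum_neg_distrib]
    linarith)
  simp only [abs_neg] at this
  linarith

/-- A weighted `ℓ¹` distance from `p` to the line `ℝ n` is attained, and a dual optimum exists. -/
theorem exists_l1_dual {ι : Type*} [Fintype ι] {s : ι → ℝ} (hs : ∀ k, 0 < s k) (n p : ι → ℝ)
    (hn : n ≠ 0) :
    ∃ (l : ℝ) (x : ι → ℝ), (∀ k, |x k| ≤ s k) ∧ ∑ k, n k * x k = 0 ∧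
      ∑ k, p k * x k = ∑ k, s k * |p k - l * n k| := by
  classical
  set f : ℝ → ℝ := fun l => ∑ k, s k * |p k - l * n k| with hf
  have hfc : Continuous f := by fun_prop
  obtain ⟨j, hj⟩ : ∃ j, n j ≠ 0 := Function.ne_iff.mp hn
  have hcoer : Filter.Tendsto f (Filter.cocompact ℝ) Filter.atTop := by
    have h1 : Filter.Tendsto (fun l : ℝ => s j * (‖l‖ * |n j| - |p j|)) (Filter.cocompact ℝ)
        Filter.atTop := by
      refine Filter.Tendsto.const_mul_atTop (hs j) ?_
      refine Filter.tendsto_atTop_add_const_right _ _ ?_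
      exact Filter.Tendsto.atTop_mul_const (abs_pos.mpr hj) tendsto_norm_cocompact_atTop
    refine Filter.tendsto_atTop_mono (fun l => ?_) h1
    calc s j * (‖l‖ * |n j| - |p j|) ≤ s j * |p j - l * n j| := by
          refine mul_le_mul_of_nonneg_left ?_ (hs j).le
          have := abs_sub_abs_le_abs_sub (l * n j) (p j)
          rw [abs_mul, abs_sub_comm] at this
          simpa using this
      _ ≤ f l := Finset.single_le_sum (f := fun k => s k * |p k - l * n k|)
          (fun k _ => mul_nonneg (hs k).le (abs_nonneg _)) (Finset.mem_univ j)
  obtain ⟨l, hl⟩ := hfc.exists_forall_le hcoer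
  set q : ι → ℝ := fun k => p k - l * n k with hq
  set Z : Finset ι := Finset.univ.filter fun k => q k = 0 with hZ
  set D : ℝ := ∑ k, n k * (s k * SignType.sign (q k)) with hD
  set E : ℝ := ∑ k ∈ Z, s k * |n k| with hE
  have hE0 : 0 ≤ E := Finset.sum_nonneg fun k _ => mul_nonneg (hs k).le (abs_nonneg _)
  -- the one-sided derivatives of `f` at its minimum
  have hder : ∀ σ : ℝ, |σ| = 1 → σ * D ≤ E := by
    intro σ hσ
    have hev : ∀ᶠ e : ℝ in nhdsWithin 0 (Ioi 0), ∀ k, q k ≠ 0 →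
        s k * |q k - e * σ * n k| = s k * |q k| - e * σ * (n k * (s k * SignType.sign (q k))) := by
      rw [Filter.eventually_all]
      intro k
      by_cases hk : q k = 0
      · simp [hk]
      have hT : Filter.Tendsto (fun e : ℝ => q k - e * σ * n k) (nhdsWithin 0 (Ioi 0))
          (nhds (q k - 0 * σ * n k)) :=
        (Continuous.tendsto (by fun_prop) _).mono_left nhdsWithin_le_nhds
      simp only [zero_mul, sub_zero] at hT
      rcases lt_or_gt_of_ne hk with h | h
      · filter_upwards [hT.eventually_lt_const h] with e he _
        rw [abs_of_neg he, abs_of_neg h, sign_neg h]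
        simp; ring
      · filter_upwards [hT.eventually_const_lt h] with e he _
        rw [abs_of_pos he, abs_of_pos h, sign_pos h]
        simp; ring
    obtain ⟨e, he, he0⟩ := (hev.and self_mem_nhdsWithin).exists
    have he0 : 0 < e := he0
    have hcomp := hl (l + e * σ)
    have h1 : f (l + e * σ) = f l - e * σ * D + e * E := by
      have h2 : E = ∑ k, if q k = 0 then s k * |n k| else 0 := by
        rw [hE, hZ, Finset.sum_filter]
      rw [hf, hD, h2]
      simp only [Finset.mul_sum]
      rw [← Finset.sum_sub_distrib, ← Finset.sum_add_distrib]
      refine Finset.sum_congr rfl fun k _ => ?_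
      have h3 : p k - (l + e * σ) * n k = q k - e * σ * n k := by simp only [hq]; ring
      rw [h3]
      by_cases hk : q k = 0
      · have h4 : p k - l * n k = 0 := hk
        simp only [hk, h4, if_true, zero_sub, abs_neg, abs_mul, hσ, abs_of_pos he0]
        simp; ring
      · rw [he k hk, if_neg hk]; simp [hq]
    rw [h1] at hcomp
    have : e * (σ * D) ≤ e * E := by nlinarith
    exact le_of_mul_le_mul_left this he0
  have hDE : |D| ≤ E := by
    have h1 := hder 1 (by simp)
    have h2 := hder (-1) (by simp)
    exact abs_le.mpr ⟨by linarith, by linarith⟩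
  -- Where `q k ≠ 0`, equality in the objective forces `x k`. The coordinates in `Z` are free and
  -- are used to cancel `D`; `|D| ≤ E` keeps them within bounds. If `E = 0`, then `D = 0` and the
  -- junk value `D / E = 0` is harmless.
  obtain ⟨x, hx⟩ : ∃ x : ι → ℝ, ∀ k, x k = if q k = 0 then - (D / E) * s k * SignType.sign (n k)
    else s k * SignType.sign (q k) := ⟨_, fun k => rfl⟩
  have hnx : ∑ k, n k * x k = 0 := by
    have h1 : ∀ k, n k * x k = n k * (s k * SignType.sign (q k))
          - (D / E) * (if q k = 0 then s k * |n k| else 0) := by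
      intro k
      rw [hx]
      by_cases hk : q k = 0
      · simp only [hk, if_true, sign_zero]
        simp only [SignType.coe_zero]
        linear_combination (-(D / E) * s k) * self_mul_sign (n k)
      · simp [hk]
    rw [Finset.sum_congr rfl fun k _ => h1 k, Finset.sum_sub_distrib, ← Finset.mul_sum,
      ← Finset.sum_filter]
    change D - D / E * E = 0
    rcases hE0.eq_or_lt with h | h
    · rw [← h] at hDE ⊢
      have := abs_nonpos_iff.mp hDE
      simp [this]
    · field_simp; ring
  refine ⟨l, x, fun k => ?_, hnx, ?_⟩
  · have hsg : ∀ r : ℝ, |((SignType.sign r : SignType) : ℝ)| ≤ 1 := fun r => by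
      rcases lt_trichotomy r 0 with h | h | h <;> simp [h]
    rw [hx]
    split_ifs
    · have h1 : |D / E| ≤ 1 := by
        rw [abs_div, abs_of_nonneg hE0]
        exact div_le_one_of_le₀ hDE hE0
      rw [abs_mul, abs_mul, abs_neg, abs_of_pos (hs k)]
      have := mul_le_mul h1 (hsg (n k)) (abs_nonneg _) zero_le_one
      nlinarith [hs k]
    · rw [abs_mul, abs_of_pos (hs k)]
      nlinarith [hs k, hsg (q k)]
  · have h1 : ∀ k, p k * x k = s k * |q k| + l * (n k * x k) := by
      intro k
      have h2 : q k * x k = s k * |q k| := by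
        rw [hx]
        split_ifs with hk
        · simp [hk]
        · rw [← self_mul_sign (q k)]; ring
      rw [← h2]
      simp only [hq]; ring
    rw [Finset.sum_congr rfl fun k _ => h1 k, Finset.sum_add_distrib, ← Finset.mul_sum, hnx,
      mul_zero, add_zero]

/-- If the slice of a moving box by a plane `n · x = d` that is central, or that meets the same four
parallel edges as the central one, has small width in direction `p`, then so has the box modulo
`n`. -/
theorem exists_l1_le_of_slice {ι : Type*} [Fintype ι] {s n p : ι → ℝ}
    (hs : ∀ k, 0 < s k) (hn : n ≠ 0) {b d η : ℝ}
    (hd : d = 0 ∨ 0 ≤ d ∧ ∃ k, d < s k * |n k| - (∑ k, s k * |n k|) / 2)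
    (hdoor : ∀ x : ι → ℝ, (∀ k, |x k| < s k / 2) → ∑ k, n k * x k = d →
      0 < η + ∑ k, p k * x k ∧ η + ∑ k, p k * x k < b) :
    ∃ l : ℝ, ∑ k, s k * |p k - l * n k| ≤ b := by
  classical
  obtain ⟨l, x, hx, hnx, hpx⟩ := exists_l1_dual hs n p hn
  refine ⟨l, ?_⟩
  rw [← hpx]
  -- a translation of a shrunk central slice into the given one
  have hτ : ∃ τ : ι → ℝ, ∑ k, n k * τ k = d ∧
      ∀ r : ℝ, |r| < 1 → ∀ k, |r / 2 * x k + τ k| < s k / 2 := by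
    have hsmall : ∀ r : ℝ, |r| < 1 → ∀ k, |r / 2 * x k| < s k / 2 := by
      intro r hr k
      rw [abs_mul, abs_div, abs_two]
      nlinarith [hx k, hs k, abs_nonneg r, abs_nonneg (x k)]
    rcases hd with rfl | ⟨hd0, j, hj⟩
    · exact ⟨0, by simp, fun r hr k => by simpa using hsmall r hr k⟩
    have hsum : ∀ f : ι → ℝ, ∑ k, f k = f j + ∑ k ∈ Finset.univ.erase j, f k := fun f =>
      (Finset.add_sum_erase _ _ (Finset.mem_univ j)).symm
    have hw : 0 ≤ ∑ k ∈ Finset.univ.erase j, s k * |n k| :=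
      Finset.sum_nonneg fun k _ => mul_nonneg (hs k).le (abs_nonneg _)
    have hnj : n j ≠ 0 := by
      intro h
      rw [hsum] at hj
      rw [h, abs_zero, mul_zero] at hj
      linarith
    -- Translate along the edge direction `j` only, so that the other coordinates keep their bounds.
    refine ⟨Pi.single j (d / n j), ?_, fun r hr k => ?_⟩
    · rw [Finset.sum_eq_single j (fun k _ hk => by simp [hk]) (by simp)]
      simp; field_simp
    by_cases hk : k = j
    · subst hk
      simp only [Pi.single_eq_same]
      -- On the central slice the term with index `j` is balanced by the others; this leaves room
      -- for the shift by `d`.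
      have h1 : |n k * x k| ≤ ∑ i ∈ Finset.univ.erase k, s i * |n i| := by
        rw [hsum] at hnx
        rw [eq_neg_of_add_eq_zero_left hnx, abs_neg]
        refine (Finset.abs_sum_le_sum_abs _ _).trans (Finset.sum_le_sum fun i _ => ?_)
        rw [abs_mul, mul_comm]
        exact mul_le_mul_of_nonneg_right (hx i) (abs_nonneg _)
      rw [hsum] at hj
      refine lt_of_mul_lt_mul_left ?_ (abs_nonneg (n k))
      rw [← abs_mul]
      have h2 : n k * (r / 2 * x k + d / n k) = r / 2 * (n k * x k) + d := by field_simp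
      rw [h2]
      refine (abs_add_le _ _).trans_lt ?_
      rw [abs_mul, abs_div, abs_two, abs_of_nonneg hd0]
      nlinarith [abs_nonneg r, abs_nonneg (n k * x k)]
    · simpa [hk] using hsmall r hr k
  obtain ⟨τ, hτd, hτ⟩ := hτ
  -- The points `τ ± (r / 2) x` both lie in the slice, and their values under `p` differ by `r * ∑
  -- k, p k * x k`.
  have key : ∀ r ∈ Ico (0 : ℝ) 1, r * ∑ k, p k * x k ≤ b := by
    intro r hr
    have hr1 : |r| < 1 := by rw [abs_of_nonneg hr.1]; exact hr.2
    have hr2 : |-r| < 1 := by rwa [abs_neg]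
    have hexp : ∀ (v : ι → ℝ) (r : ℝ),
        ∑ k, v k * (r / 2 * x k + τ k) = r / 2 * ∑ k, v k * x k + ∑ k, v k * τ k := by
      intro v r
      rw [Finset.mul_sum, ← Finset.sum_add_distrib]
      exact Finset.sum_congr rfl fun k _ => by ring
    have h1 := hdoor _ (hτ r hr1) (by rw [hexp, hnx, hτd]; ring)
    have h2 := hdoor _ (hτ (-r) hr2) (by rw [hexp, hnx, hτd]; ring)
    rw [hexp] at h1 h2
    linarith [h1.2, h2.1]
  have hT : Filter.Tendsto (fun r : ℝ => r * ∑ k, p k * x k) (nhdsWithin 1 (Iio 1))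
      (nhds (1 * ∑ k, p k * x k)) :=
    (Continuous.tendsto (by fun_prop) _).mono_left nhdsWithin_le_nhds
  rw [one_mul] at hT
  refine le_of_tendsto hT ?_
  filter_upwards [Ico_mem_nhdsLT (zero_lt_one' ℝ)] with r hr using key r hr

/-- The times at which a weighted `ℓ¹` distance from `p` to the line `ℝ n` is at most `b` form a
closed set. -/
theorem isClosed_setOf_exists_l1_le {ι X : Type*} [Fintype ι] [TopologicalSpace X] [CompactSpace X]
    [T2Space X] {s : ι → ℝ} (hs : ∀ k, 0 < s k) {n p : X → ι → ℝ} (hn : Continuous n)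
    (hp : Continuous p) (hn1 : ∀ t, ∑ k, n t k ^ 2 = 1) (b : ℝ) :
    IsClosed {t | ∃ l : ℝ, ∑ k, s k * |p t k - l * n t k| ≤ b} := by
  have hw : Continuous fun t => ∑ k, s k * |n t k| := by fun_prop
  have hpc : Continuous fun t => ∑ k, s k * |p t k| := by fun_prop
  have hw0 : ∀ t, 0 < ∑ k, s k * |n t k| := by
    intro t
    have h0 : ∀ k ∈ Finset.univ, 0 ≤ s k * |n t k| := fun k _ =>
      mul_nonneg (hs k).le (abs_nonneg _)
    refine lt_of_le_of_ne (Finset.sum_nonneg h0) fun h => ?_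
    have h1 := (Finset.sum_eq_zero_iff_of_nonneg h0).mp h.symm
    have h2 := hn1 t
    rw [Finset.sum_eq_zero] at h2
    · simp at h2
    · intro k hk
      rcases mul_eq_zero.mp (h1 k hk) with h | h
      · exact absurd h (hs k).ne'
      · simp [abs_eq_zero.mp h]
  -- a bound for the multipliers
  have hB : Continuous fun t => (b + ∑ k, s k * |p t k|) / ∑ k, s k * |n t k| :=
    (continuous_const.add hpc).div hw fun t => (hw0 t).ne'
  obtain ⟨B, hBB⟩ := (isCompact_range hB).bddAbove
  -- Bounded multipliers turn the set into a projection of a compact set.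
  have hset : {t | ∃ l : ℝ, ∑ k, s k * |p t k - l * n t k| ≤ b} = Prod.fst ''
      ({q : X × ℝ | ∑ k, s k * |p q.1 k - q.2 * n q.1 k| ≤ b} ∩ univ ×ˢ Icc (-B) B) := by
    ext t
    constructor
    · rintro ⟨l, hl⟩
      refine ⟨(t, l), ⟨hl, mem_univ _, abs_le.mp ?_⟩, rfl⟩
      refine le_trans ?_ (hBB (mem_range_self t))
      rw [le_div_iff₀ (hw0 t), Finset.mul_sum]
      have h1 : ∑ k, |l| * (s k * |n t k|) ≤ ∑ k, (s k * |p t k - l * n t k| + s k * |p t k|) := by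
        refine Finset.sum_le_sum fun k _ => ?_
        have h2 := abs_sub_abs_le_abs_sub (l * n t k) (p t k)
        rw [abs_mul, abs_sub_comm] at h2
        nlinarith [hs k]
      rw [Finset.sum_add_distrib] at h1
      linarith
    · rintro ⟨⟨t', l⟩, ⟨h, -⟩, rfl⟩
      exact ⟨l, h⟩
  rw [hset]
  have hcl : IsClosed {q : X × ℝ | ∑ k, s k * |p q.1 k - q.2 * n q.1 k| ≤ b} :=
    isClosed_le (by fun_prop) continuous_const
  exact ((isCompact_univ.prod isCompact_Icc).inter_left hcl).image continuous_fst |>.isClosed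

/-! ### The determinant bound, its equality cases, and orthogonal matrices -/

/-- A bound for a `3 × 3` determinant with rows `N`, `Q`, `H`, with its defect. -/
theorem abs_det_add_defect_le (A : ℝ) (N Q H : Fin 3 → ℝ) :
    |N 0 * (Q 1 * H 2 - Q 2 * H 1) - N 1 * (Q 0 * H 2 - Q 2 * H 0)
        + N 2 * (Q 0 * H 1 - Q 1 * H 0)|
      + ((|Q 1| * |H 2| + |Q 2| * |H 1|) * (A - |N 0|) + (|Q 0| * |H 2| + |Q 2| * |H 0|) * (A - |N 1|)
        + (|Q 0| * |H 1| + |Q 1| * |H 0|) * (A - |N 2|))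
      + A * (|Q 0| * |H 0| + |Q 1| * |H 1| + |Q 2| * |H 2|)
      ≤ A * ((∑ k, |Q k|) * ∑ k, |H k|) := by
  have h : ∀ u v w x y : ℝ, |u * (v * w - x * y)| ≤ |u| * (|v| * |w| + |x| * |y|) := by
    intro u v w x y
    rw [abs_mul]
    refine mul_le_mul_of_nonneg_left ?_ (abs_nonneg _)
    rw [← abs_mul, ← abs_mul]
    exact abs_sub _ _
  have h0 := h (N 0) (Q 1) (H 2) (Q 2) (H 1)
  have h1 := h (N 1) (Q 0) (H 2) (Q 2) (H 0)
  have h2 := h (N 2) (Q 0) (H 1) (Q 1) (H 0)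
  have h3 : |N 0 * (Q 1 * H 2 - Q 2 * H 1) - N 1 * (Q 0 * H 2 - Q 2 * H 0)
        + N 2 * (Q 0 * H 1 - Q 1 * H 0)| ≤ |N 0 * (Q 1 * H 2 - Q 2 * H 1)|
        + |N 1 * (Q 0 * H 2 - Q 2 * H 0)| + |N 2 * (Q 0 * H 1 - Q 1 * H 0)| :=
    (abs_add_le _ _).trans (add_le_add_left (abs_sub _ _) _)
  simp only [Fin.sum_univ_three]
  linarith

/-- Equality in the determinant bound: either the last row is supported on one coordinate, or the
middle row is, and then the other two entries of the first row are extremal. -/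
theorem support_of_det_bound {a b c : ℝ} (ha : 0 < a) (hb : 0 < b) (hc : 0 < c) {N Q H : Fin 3 → ℝ}
    (hN : ∀ k, |N k| ≤ a) (hQ : ∑ k, |Q k| ≤ b) (hH : ∑ k, |H k| ≤ c)
    (hD : a * b * c ≤ |N 0 * (Q 1 * H 2 - Q 2 * H 1) - N 1 * (Q 0 * H 2 - Q 2 * H 0)
        + N 2 * (Q 0 * H 1 - Q 1 * H 0)|) :
    ∑ k, |Q k| = b ∧ ∑ k, |H k| = c ∧
      ((∃ k, ∀ j ≠ k, H j = 0) ∨ ∃ i, H i = 0 ∧ ∀ j ≠ i, Q j = 0 ∧ H j ≠ 0 ∧ |N j| = a) := by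
  have hdef := abs_det_add_defect_le a N Q H
  have hQ0 : 0 ≤ ∑ k, |Q k| := Finset.sum_nonneg fun k _ => abs_nonneg _
  have hH0 : 0 ≤ ∑ k, |H k| := Finset.sum_nonneg fun k _ => abs_nonneg _
  have hprod : (∑ k, |Q k|) * ∑ k, |H k| ≤ b * c := mul_le_mul hQ hH hH0 hb.le
  have hm : ∀ i j, 0 ≤ |Q i| * |H j| := fun i j => by positivity
  have hd : ∀ k i j, 0 ≤ |Q i| * |H j| * (a - |N k|) := fun k i j =>
    mul_nonneg (hm i j) (by linarith [hN k])
  have hap := mul_le_mul_of_nonneg_left hprod ha.le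
  have hz : ∀ {i}, a * (|Q i| * |H i|) ≤ 0 → Q i = 0 ∨ H i = 0 := by
    intro i h
    have h1 : |Q i| * |H i| = 0 := le_antisymm (by nlinarith) (hm i i)
    simpa using h1
  have hz' : ∀ {i j k}, |Q i| * |H j| * (a - |N k|) ≤ 0 → Q i = 0 ∨ H j = 0 ∨ |N k| = a := by
    intro i j k h
    have h1 := le_antisymm h (hd k i j)
    simpa [sub_eq_zero, or_assoc, eq_comm (a := a)] using h1
  have ham : ∀ i j, 0 ≤ a * (|Q i| * |H j|) := fun i j => mul_nonneg ha.le (hm i j)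
  -- The defect terms are nonnegative with sum at most zero, so each of them vanishes.
  have e0 : Q 0 = 0 ∨ H 0 = 0 := hz (by
    linarith [ham 1 1, ham 2 2, hd 0 1 2, hd 0 2 1, hd 1 0 2, hd 1 2 0, hd 2 0 1, hd 2 1 0])
  have e1 : Q 1 = 0 ∨ H 1 = 0 := hz (by
    linarith [ham 0 0, ham 2 2, hd 0 1 2, hd 0 2 1, hd 1 0 2, hd 1 2 0, hd 2 0 1, hd 2 1 0])
  have e2 : Q 2 = 0 ∨ H 2 = 0 := hz (by
    linarith [ham 0 0, ham 1 1, hd 0 1 2, hd 0 2 1, hd 1 0 2, hd 1 2 0, hd 2 0 1, hd 2 1 0])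
  have f012 : Q 1 = 0 ∨ H 2 = 0 ∨ |N 0| = a := hz' (by
    linarith [ham 0 0, ham 1 1, ham 2 2, hd 0 2 1, hd 1 0 2, hd 1 2 0, hd 2 0 1, hd 2 1 0])
  have f021 : Q 2 = 0 ∨ H 1 = 0 ∨ |N 0| = a := hz' (by
    linarith [ham 0 0, ham 1 1, ham 2 2, hd 0 1 2, hd 1 0 2, hd 1 2 0, hd 2 0 1, hd 2 1 0])
  have f102 : Q 0 = 0 ∨ H 2 = 0 ∨ |N 1| = a := hz' (by
    linarith [ham 0 0, ham 1 1, ham 2 2, hd 0 1 2, hd 0 2 1, hd 1 2 0, hd 2 0 1, hd 2 1 0])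
  have f120 : Q 2 = 0 ∨ H 0 = 0 ∨ |N 1| = a := hz' (by
    linarith [ham 0 0, ham 1 1, ham 2 2, hd 0 1 2, hd 0 2 1, hd 1 0 2, hd 2 0 1, hd 2 1 0])
  have f201 : Q 0 = 0 ∨ H 1 = 0 ∨ |N 2| = a := hz' (by
    linarith [ham 0 0, ham 1 1, ham 2 2, hd 0 1 2, hd 0 2 1, hd 1 0 2, hd 1 2 0, hd 2 1 0])
  have f210 : Q 1 = 0 ∨ H 0 = 0 ∨ |N 2| = a := hz' (by
    linarith [ham 0 0, ham 1 1, ham 2 2, hd 0 1 2, hd 0 2 1, hd 1 0 2, hd 1 2 0, hd 2 0 1])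
  have hbc : b * c ≤ (∑ k, |Q k|) * ∑ k, |H k| := by
    refine le_of_mul_le_mul_left ?_ ha
    linarith [ham 0 0, ham 1 1, ham 2 2, hd 0 1 2, hd 0 2 1, hd 1 0 2, hd 1 2 0, hd 2 0 1,
      hd 2 1 0]
  have hQb : ∑ k, |Q k| = b := le_antisymm hQ (by
    by_contra h; push Not at h; nlinarith)
  have hHc : ∑ k, |H k| = c := le_antisymm hH (by
    by_contra h; push Not at h; nlinarith)
  refine ⟨hQb, hHc, ?_⟩
  have hQne : Q 0 ≠ 0 ∨ Q 1 ≠ 0 ∨ Q 2 ≠ 0 := by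
    by_contra! h
    rw [Fin.sum_univ_three, h.1, h.2.1, h.2.2] at hQb
    simp at hQb; linarith
  simp only [Fin.exists_fin_succ, Fin.forall_fin_succ, Fin.succ_zero_eq_one, Fin.succ_one_eq_two]
  -- No zero in `H` would force `Q = 0`; exactly one gives the second alternative, and two or three
  -- give the first.
  by_cases h0 : H 0 = 0 <;> by_cases h1 : H 1 = 0 <;> by_cases h2 : H 2 = 0 <;>
    simp_all

/-- Orthogonal `3 × 3` matrices, in coordinates. -/
theorem orthogonal_relations {M : Matrix (Fin 3) (Fin 3) ℝ} (hM : M * M.transpose = 1) :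
    (∀ i, ∑ k, M i k ^ 2 = 1) ∧ (∀ k, ∑ i, M i k ^ 2 = 1) ∧
      (∀ i j, i ≠ j → ∑ k, M i k * M j k = 0) := by
  have hM' : M.transpose * M = 1 := mul_eq_one_comm.mp hM
  refine ⟨fun i => ?_, fun k => ?_, fun i j hij => ?_⟩
  · have := congrFun (congrFun hM i) i
    simpa [Matrix.mul_apply, sq] using this
  · have := congrFun (congrFun hM' k) k
    simpa [Matrix.mul_apply, sq] using this
  · have := congrFun (congrFun hM i) j
    simpa [Matrix.mul_apply, hij] using this

theorem abs_det_eq_one {M : Matrix (Fin 3) (Fin 3) ℝ} (hM : M * M.transpose = 1) : |M.det| = 1 := by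
  have h := congrArg Matrix.det hM
  rw [Matrix.det_mul, Matrix.det_transpose, Matrix.det_one] at h
  rw [← abs_mul_abs_self] at h
  nlinarith [abs_nonneg M.det]

/-- The volume of a box as a determinant with a sheared middle row. -/
theorem prod_eq_abs_det {M : Matrix (Fin 3) (Fin 3) ℝ} (hM : M * M.transpose = 1) {s : Fin 3 → ℝ}
    (hs : ∀ k, 0 < s k) (l : ℝ) {N Q H : Fin 3 → ℝ} (hN : ∀ k, N k = s k * M 0 k)
    (hQ : ∀ k, Q k = s k * (M 1 k - l * M 0 k)) (hH : ∀ k, H k = s k * M 2 k) :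
    s 0 * s 1 * s 2 = |N 0 * (Q 1 * H 2 - Q 2 * H 1) - N 1 * (Q 0 * H 2 - Q 2 * H 0)
        + N 2 * (Q 0 * H 1 - Q 1 * H 0)| := by
  have h : N 0 * (Q 1 * H 2 - Q 2 * H 1) - N 1 * (Q 0 * H 2 - Q 2 * H 0)
        + N 2 * (Q 0 * H 1 - Q 1 * H 0) = s 0 * s 1 * s 2 * M.det := by
    rw [Matrix.det_fin_three]
    simp only [hN, hQ, hH]
    ring
  rw [h, abs_mul, abs_det_eq_one hM, mul_one, abs_of_pos]
  exact mul_pos (mul_pos (hs 0) (hs 1)) (hs 2)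

/-- The cofactor formula for the entries of the middle row of an orthogonal matrix. -/
theorem abs_middle_row_eq {M : Matrix (Fin 3) (Fin 3) ℝ} (hM : M * M.transpose = 1) (i : Fin 3) :
    |M 1 i| = |M 0 (i + 1) * M 2 (i + 2) - M 0 (i + 2) * M 2 (i + 1)| := by
  have hdet := abs_det_eq_one hM
  have hadj : M.adjugate = M.det • M.transpose := by
    have h := Matrix.adjugate_mul M
    calc M.adjugate = M.adjugate * (M * M.transpose) := by rw [hM, mul_one]
      _ = _ := by rw [← mul_assoc, h, Matrix.smul_mul, one_mul]
  have h := congrFun (congrFun hadj i) 1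
  rw [Matrix.smul_apply, Matrix.transpose_apply, smul_eq_mul] at h
  have h2 : |M 1 i| = |M.adjugate i 1| := by rw [h, abs_mul, hdet, one_mul]
  rw [h2, Matrix.adjugate_fin_three]
  fin_cases i <;> simp
  · rw [← abs_neg]; congr 1; ring
  · rw [← abs_neg]; congr 1; ring
  · rw [← abs_neg]; congr 1; ring

/-- Permits treating an arbitrary distinguished edge `i` without cases, the other two being `i + 1`
and `i + 2`. -/
theorem sum_fin_three_cyclic (f : Fin 3 → ℝ) (i : Fin 3) :
    ∑ k, f k = f i + f (i + 1) + f (i + 2) := by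
  rw [Fin.sum_univ_three]
  fin_cases i
  · rfl
  · change _ = f 1 + f 2 + f 0; ring
  · change _ = f 2 + f 0 + f 1; ring

theorem prod_fin_three_cyclic (f : Fin 3 → ℝ) (i : Fin 3) :
    f 0 * f 1 * f 2 = f i * f (i + 1) * f (i + 2) := by
  fin_cases i
  · rfl
  · change _ = f 1 * f 2 * f 0; ring
  · change _ = f 2 * f 0 * f 1; ring

theorem forall_ne_fin_three {P : Fin 3 → Prop} {i : Fin 3} :
    (∀ j ≠ i, P j) ↔ P (i + 1) ∧ P (i + 2) := by
  have h : ∀ i j : Fin 3, j ≠ i ↔ j = i + 1 ∨ j = i + 2 := by decide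
  simp [h, or_imp, forall_and]

/-- The orientation of a box of side lengths `s` near one in which a face diagonal plane is the
section by the door: the edges of direction `i` stay parallel to the second coordinate axis. -/
theorem abs_middle_eq_one_of_near {a b c κ : ℝ} (ha : 0 < a) {s : Fin 3 → ℝ} (hs : ∀ k, 0 < s k)
    {i : Fin 3} (hsi : s i = b) (hV : s 0 * s 1 * s 2 = a * b * c)
    {M : Matrix (Fin 3) (Fin 3) ℝ} (hM : M * M.transpose = 1)
    (hN : ∀ k, s k * |M 0 k| ≤ a) (hW : ∑ k, s k * |M 0 k| ≤ 2 * a)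
    (hH : ∑ k, s k * |M 2 k| ≤ c)
    (h1 : κ ≤ s (i + 1) * |M 2 (i + 1)|) (h2 : κ ≤ s (i + 2) * |M 2 (i + 2)|)
    (hm : |M 2 i| * c < b) (hn : a * c * |M 0 i| < b * κ) :
    |M 1 i| = 1 := by
  have hb : 0 < b := hsi ▸ hs i
  rw [prod_fin_three_cyclic s i, hsi] at hV
  have hss : s (i + 1) * s (i + 2) = a * c := by
    refine mul_left_cancel₀ hb.ne' ?_
    linarith
  rw [sum_fin_three_cyclic _ i, hsi] at hW hH
  have hcol := (orthogonal_relations hM).2.1 i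
  rw [Fin.sum_univ_three] at hcol
  have hp : |M 1 i| ≤ |M 0 (i + 1)| * |M 2 (i + 2)| + |M 0 (i + 2)| * |M 2 (i + 1)| := by
    rw [abs_middle_row_eq hM i, ← abs_mul, ← abs_mul]
    exact abs_sub _ _
  set n0 := |M 0 i|
  set n1 := |M 0 (i + 1)|
  set n2 := |M 0 (i + 2)|
  set m0 := |M 2 i|
  set m1 := |M 2 (i + 1)|
  set m2 := |M 2 (i + 2)|
  have hn0 : 0 ≤ n0 := abs_nonneg _
  have hm0 : 0 ≤ m0 := abs_nonneg _
  have hcol' : n0 ^ 2 + |M 1 i| ^ 2 + m0 ^ 2 = 1 := by simpa only [n0, m0, sq_abs] using hcol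
  have hp0 : 0 ≤ |M 1 i| := abs_nonneg _
  have hsp : a * c * |M 1 i| ≤ s (i + 1) * n1 * (s (i + 2) * m2) + s (i + 2) * n2 * (s (i + 1) * m1) := by
    have h0 : 0 ≤ s (i + 1) * s (i + 2) := (mul_pos (hs _) (hs _)).le
    have := mul_le_mul_of_nonneg_left hp h0
    rw [hss] at this
    calc _ ≤ _ := this
      _ = _ := by rw [← hss]; ring
  have hN1 := hN (i + 1)
  have hN2 := hN (i + 2)
  have g1 := mul_nonneg (sub_nonneg.mpr hN1) (sub_nonneg.mpr h2)
  have g2 := mul_nonneg (sub_nonneg.mpr hN2) (sub_nonneg.mpr h1)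
  have hac : 0 < a * c := hss ▸ mul_pos (hs _) (hs _)
  have hκ : 0 < κ := by
    have : 0 ≤ a * c * n0 := by positivity
    exact pos_of_mul_pos_right (lt_of_le_of_lt this hn) hb.le
  have g3 : κ * (b * n0) ≤ κ * (2 * a - s (i + 1) * n1 - s (i + 2) * n2) :=
    mul_le_mul_of_nonneg_left (by linarith) hκ.le
  have g4 : a * (b * m0) ≤ a * (c - s (i + 1) * m1 - s (i + 2) * m2) :=
    mul_le_mul_of_nonneg_left (by linarith) ha.le
  have hple : |M 1 i| ^ 2 ≤ |M 1 i| := by nlinarith [sq_nonneg n0, sq_nonneg m0]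
  have g5 := mul_le_mul_of_nonneg_left hple hac.le
  -- Tilting the edge costs a first-order amount in `m0` and `n0` in the cofactor bound for `a * c *
  -- |M 1 i|`, but lowers `|M 1 i| ^ 2` only to second order. For small tilts this leaves only `m0 =
  -- n0 = 0`.
  have key : m0 * (a * (b - m0 * c)) + n0 * (b * κ - a * c * n0) ≤ 0 := by
    have : a * c * |M 1 i| ^ 2 = a * c - a * c * n0 ^ 2 - a * c * m0 ^ 2 := by
      linear_combination a * c * hcol'
    nlinarith
  have k1 : 0 ≤ m0 * (a * (b - m0 * c)) := mul_nonneg hm0 (mul_nonneg ha.le (by linarith))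
  have k2 : 0 ≤ n0 * (b * κ - a * c * n0) := mul_nonneg hn0 (by linarith)
  have z1 : m0 = 0 := by
    have : m0 * (a * (b - m0 * c)) = 0 := by linarith
    exact (mul_eq_zero.mp this).resolve_right (mul_pos ha (by linarith)).ne'
  have z2 : n0 = 0 := by
    have : n0 * (b * κ - a * c * n0) = 0 := by linarith
    exact (mul_eq_zero.mp this).resolve_right (by linarith : 0 < b * κ - a * c * n0).ne'
  rw [z1, z2] at hcol'
  have : (|M 1 i| - 1) * (|M 1 i| + 1) = 0 := by linarith
  rcases mul_eq_zero.mp this with h | h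
  · linarith
  · linarith

/-- An orthogonal matrix having an entry of absolute value one. -/
theorem row_eq_zero_of_abs_eq_one {M : Matrix (Fin 3) (Fin 3) ℝ} (hM : M * M.transpose = 1)
    {r k : Fin 3} (h : |M r k| = 1) : ∀ j ≠ k, M r j = 0 := by
  have h1 := (orthogonal_relations hM).1 r
  rw [sum_fin_three_cyclic _ k, ← sq_abs (M r k), h] at h1
  rw [forall_ne_fin_three]
  constructor <;> exact pow_eq_zero_iff two_ne_zero |>.mp (by nlinarith)

/-- A box of height `c` that moves in a slab of height `c` keeps its vertical edges vertical. -/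
theorem abs_row_eq_one_of_slab {X : Type*} [TopologicalSpace X] [PreconnectedSpace X] {c : ℝ}
    {s : Fin 3 → ℝ} (hs : ∀ k, 0 < s k) {O : X → Matrix (Fin 3) (Fin 3) ℝ} (hOc : Continuous O)
    (hO : ∀ t, O t * (O t).transpose = 1) (hh : ∀ t, ∑ k, s k * |O t 2 k| ≤ c) {k : Fin 3}
    (hk : s k = c) {t₁ : X} (ht₁ : |O t₁ 2 k| = 1) (t : X) : |O t 2 k| = 1 := by
  have hc : 0 < c := hk ▸ hs k
  have hcont : ∀ i j, Continuous fun t => O t i j := fun i j => by fun_prop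
  have hcl : IsClosed {t | |O t 2 k| = 1} := isClosed_eq (hcont 2 k).abs continuous_const
  -- Near a vertical position, the height bound loses a linear amount in the tilts `y`, `z`, while
  -- the unit length of the row gives back only a quadratic one; hence the tilts vanish.
  have hop : IsOpen {t | |O t 2 k| = 1} := by
    rw [isOpen_iff_mem_nhds]
    intro t₀ ht₀
    have hz := row_eq_zero_of_abs_eq_one (hO t₀) ht₀
    rw [forall_ne_fin_three] at hz
    have e1 : ∀ᶠ t in nhds t₀, c * |O t 2 (k + 1)| < s (k + 1) :=
      ((continuous_const.mul (hcont 2 (k + 1)).abs).tendsto t₀).eventually_lt_const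
        (by simp [hz.1, hs])
    have e2 : ∀ᶠ t in nhds t₀, c * |O t 2 (k + 2)| < s (k + 2) :=
      ((continuous_const.mul (hcont 2 (k + 2)).abs).tendsto t₀).eventually_lt_const
        (by simp [hz.2, hs])
    filter_upwards [e1, e2] with t h1 h2
    have hrow := (orthogonal_relations (hO t)).1 2
    have hht := hh t
    rw [sum_fin_three_cyclic _ k] at hrow hht
    rw [← sq_abs, ← sq_abs (O t 2 (k + 1)), ← sq_abs (O t 2 (k + 2))] at hrow
    rw [hk] at hht
    change |O t 2 k| = 1
    set x := |O t 2 k|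
    set y := |O t 2 (k + 1)|
    set z := |O t 2 (k + 2)|
    have hx : 0 ≤ x := abs_nonneg _
    have hy : 0 ≤ y := abs_nonneg _
    have hz : 0 ≤ z := abs_nonneg _
    have hxx : x ^ 2 ≤ x := by nlinarith
    have key : y * (s (k + 1) - c * y) + z * (s (k + 2) - c * z) ≤ 0 := by
      have := mul_le_mul_of_nonneg_left hxx hc.le
      nlinarith
    have k1 : 0 ≤ y * (s (k + 1) - c * y) := mul_nonneg hy (by linarith)
    have k2 : 0 ≤ z * (s (k + 2) - c * z) := mul_nonneg hz (by linarith)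
    have z1 : y = 0 := by
      have : y * (s (k + 1) - c * y) = 0 := by linarith
      exact (mul_eq_zero.mp this).resolve_right (by linarith : 0 < s (k + 1) - c * y).ne'
    have z2 : z = 0 := by
      have : z * (s (k + 2) - c * z) = 0 := by linarith
      exact (mul_eq_zero.mp this).resolve_right (by linarith : 0 < s (k + 2) - c * z).ne'
    rw [z1, z2] at hrow
    nlinarith
  have huniv := IsClopen.eq_univ ⟨hcl, hop⟩ ⟨t₁, ht₁⟩
  exact huniv.ge (mem_univ t)

/-! ### Passage through the door -/

/-- The data of a box with side lengths `s` moving through the door `{a} × (0, b)` in a slab of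
height `c`: the orientation `O t`, and the first two coordinates `ξ t`, `η t` of the centre. -/
structure DoorPassage (a b c : ℝ) (s : Fin 3 → ℝ) (O : unitInterval → Matrix (Fin 3) (Fin 3) ℝ)
    (ξ η : unitInterval → ℝ) : Prop where
  pos : ∀ k, 0 < s k
  continuous_orientation : Continuous O
  continuous_center : Continuous ξ
  orthogonal : ∀ t, O t * (O t).transpose = 1
  nonneg : ∀ t, ∀ x : Fin 3 → ℝ, (∀ k, |x k| < s k / 2) → 0 ≤ ξ t + ∑ k, O t 0 k * x k
  start_le : ∀ x : Fin 3 → ℝ, (∀ k, |x k| < s k / 2) → ξ 0 + ∑ k, O 0 0 k * x k ≤ a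
  le_end : a ≤ ξ 1
  door : ∀ t, ∀ x : Fin 3 → ℝ, (∀ k, |x k| < s k / 2) → ξ t + ∑ k, O t 0 k * x k = a →
    0 < η t + ∑ k, O t 1 k * x k ∧ η t + ∑ k, O t 1 k * x k < b
  height_le : ∀ t, ∑ k, s k * |O t 2 k| ≤ c

namespace DoorPassage

variable {a b c : ℝ} {s : Fin 3 → ℝ} {O : unitInterval → Matrix (Fin 3) (Fin 3) ℝ}
  {ξ η : unitInterval → ℝ}

theorem continuous_entry (h : DoorPassage a b c s O ξ η) (i j : Fin 3) :
    Continuous fun t => O t i j := by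
  have := h.continuous_orientation
  fun_prop

theorem row_ne_zero (h : DoorPassage a b c s O ξ η) (t : unitInterval) (i : Fin 3) :
    O t i ≠ 0 := by
  intro h0
  have h1 := (orthogonal_relations (h.orthogonal t)).1 i
  simp [h0] at h1

theorem half_width_le (h : DoorPassage a b c s O ξ η) (t : unitInterval) :
    (∑ k, s k * |O t 0 k|) / 2 ≤ ξ t := by
  have := half_sum_le_of_forall_box h.pos (h.nonneg t)
  linarith

theorem start_half_width_le (h : DoorPassage a b c s O ξ η) :
    (∑ k, s k * |O 0 0 k|) / 2 ≤ a - ξ 0 := by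
  have := add_half_sum_le_of_forall_box h.pos h.start_le
  linarith

theorem width_nonneg (h : DoorPassage a b c s O ξ η) (t : unitInterval) (k : Fin 3) :
    s k * |O t 0 k| ≤ ∑ k, s k * |O t 0 k| ∧ 0 ≤ ∑ k, s k * |O t 0 k| := by
  have h0 : ∀ k ∈ Finset.univ, 0 ≤ s k * |O t 0 k| := fun k _ =>
    mul_nonneg (h.pos k).le (abs_nonneg _)
  exact ⟨Finset.single_le_sum h0 (Finset.mem_univ k), Finset.sum_nonneg h0⟩

theorem exists_l1_le (h : DoorPassage a b c s O ξ η) {t : unitInterval}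
    (hd : a - ξ t = 0 ∨ 0 ≤ a - ξ t ∧
      ∃ k, a - ξ t < s k * |O t 0 k| - (∑ k, s k * |O t 0 k|) / 2) :
    ∃ l : ℝ, ∑ k, s k * |O t 1 k - l * O t 0 k| ≤ b :=
  exists_l1_le_of_slice h.pos (h.row_ne_zero t 0) hd fun x hx hxd =>
    h.door t x hx (by linarith)

/-- There is a first time at which the box is narrow enough for the door. At this time, most of
the box is still in the first arm. -/
theorem exists_first_narrow (h : DoorPassage a b c s O ξ η) :
    ∃ t₁, (∃ l : ℝ, ∑ k, s k * |O t₁ 1 k - l * O t₁ 0 k| ≤ b) ∧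
      (∀ t < t₁, ¬ ∃ l : ℝ, ∑ k, s k * |O t 1 k - l * O t 0 k| ≤ b) ∧
      ∀ t ≤ t₁, ∑ k, s k * |O t 0 k| ≤ 2 * a ∧ ∀ k, s k * |O t 0 k| ≤ a := by
  set G : Set unitInterval := {t | ∃ l : ℝ, ∑ k, s k * |O t 1 k - l * O t 0 k| ≤ b} with hG
  have hrow : ∀ i, Continuous fun t => O t i := fun i => continuous_pi fun j => h.continuous_entry i j
  have hcl : IsClosed G := isClosed_setOf_exists_l1_le h.pos (hrow 0) (hrow 1)
    (fun t => (orthogonal_relations (h.orthogonal t)).1 0) b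
  have hd : Continuous fun t => a - ξ t := continuous_const.sub h.continuous_center
  have hd0 : 0 ≤ a - ξ 0 :=
    le_trans (by linarith [(h.width_nonneg 0 0).2]) h.start_half_width_le
  have hzero : ∀ t, a - ξ t ≤ 0 → ∃ t' ≤ t, a - ξ t' = 0 := by
    intro t ht
    obtain ⟨t', ht', h'⟩ := intermediate_value_Icc' (bot_le : (0 : unitInterval) ≤ t)
      hd.continuousOn ⟨ht, hd0⟩
    exact ⟨t', ht'.2, h'⟩
  have hne : G.Nonempty := by
    obtain ⟨t', -, ht'⟩ := hzero 1 (by linarith [h.le_end])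
    exact ⟨t', h.exists_l1_le (Or.inl ht')⟩
  obtain ⟨t₁, ht₁, hmin⟩ := hcl.isCompact.exists_isLeast hne
  have hnot : ∀ t < t₁, t ∉ G := fun t ht h' => absurd (hmin h') (not_le.mpr ht)
  -- Had the centre already passed the door plane, it would have met it earlier, at a narrow time; a
  -- failure of the second bound gives a narrow time through a non-central slice.
  have hlt : ∀ t < t₁, 0 ≤ a - ξ t ∧
      ∀ k, s k * |O t 0 k| - (∑ k, s k * |O t 0 k|) / 2 ≤ a - ξ t := by
    intro t ht
    have h0 : 0 ≤ a - ξ t := by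
      by_contra! hneg
      obtain ⟨t', htt', h'⟩ := hzero t hneg.le
      exact hnot t' (htt'.trans_lt ht) (h.exists_l1_le (Or.inl h'))
    refine ⟨h0, fun k => ?_⟩
    by_contra! hk
    exact hnot t ht (h.exists_l1_le (Or.inr ⟨h0, k, hk⟩))
  have hle : ∀ t ≤ t₁, 0 ≤ a - ξ t ∧
      ∀ k, s k * |O t 0 k| - (∑ k, s k * |O t 0 k|) / 2 ≤ a - ξ t := by
    intro t ht
    rcases ht.lt_or_eq with ht | rfl
    · exact hlt t ht
    -- At `t₁` itself the bounds are limits of earlier ones, unless `t₁ = 0`, where the starting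
    -- position supplies them.
    rcases eq_or_ne t 0 with rfl | ht0
    · refine ⟨hd0, fun k => ?_⟩
      linarith [h.start_half_width_le, (h.width_nonneg 0 k).1]
    · have hclos : t ∈ closure (Iio t) := by
        rw [closure_Iio' ⟨0, lt_of_le_of_ne bot_le ht0.symm⟩]
        exact self_mem_Iic
      have hc : IsClosed {t : unitInterval | 0 ≤ a - ξ t ∧
          ∀ k, s k * |O t 0 k| - (∑ k, s k * |O t 0 k|) / 2 ≤ a - ξ t} := by
        have hO := h.continuous_orientation
        have hξ := h.continuous_center
        rw [ofPred_and, ofPred_forall]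
        exact (isClosed_le continuous_const hd).inter
          (isClosed_iInter fun k => isClosed_le (by fun_prop) hd)
      exact closure_minimal (fun t ht => hlt t ht) hc hclos
  refine ⟨t₁, ht₁, hnot, fun t ht => ?_⟩
  -- Since the box has nonnegative first coordinates, `ξ t` is at least half the width; this turns
  -- the bounds on `a - ξ t` into bounds by `a`.
  have h1 := hle t ht
  have h2 := h.half_width_le t
  exact ⟨by linarith [h1.1], fun k => by linarith [h1.2 k]⟩

/-- At the first narrow time, subtracting `l` times the first row from the middle one preserves the
determinant and makes its weighted `ℓ¹` norm at most `b`; the determinant bound then applies. -/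
theorem volume_le (h : DoorPassage a b c s O ξ η) (ha : 0 < a) : s 0 * s 1 * s 2 ≤ a * b * c := by
  obtain ⟨t, ⟨l, hl⟩, -, ht⟩ := h.exists_first_narrow
  have hN := (ht t le_rfl).2
  have hs := h.pos
  have habs : ∀ k v, |s k * v| = s k * |v| := fun k v => by rw [abs_mul, abs_of_pos (hs k)]
  set N : Fin 3 → ℝ := fun k => s k * O t 0 k
  set Q : Fin 3 → ℝ := fun k => s k * (O t 1 k - l * O t 0 k)
  set H : Fin 3 → ℝ := fun k => s k * O t 2 k
  rw [prod_eq_abs_det (h.orthogonal t) hs l (N := N) (Q := Q) (H := H) (fun _ => rfl)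
    (fun _ => rfl) (fun _ => rfl)]
  have hQ : ∑ k, |Q k| ≤ b := by simpa only [Q, habs] using hl
  have hH : ∑ k, |H k| ≤ c := by simpa only [H, habs] using h.height_le t
  have hN' : ∀ k, 0 ≤ a - |N k| := fun k => by
    simpa only [N, habs, sub_nonneg] using hN k
  have hdef := abs_det_add_defect_le a N Q H
  have hQ0 : 0 ≤ ∑ k, |Q k| := Finset.sum_nonneg fun k _ => abs_nonneg _
  have hH0 : 0 ≤ ∑ k, |H k| := Finset.sum_nonneg fun k _ => abs_nonneg _
  have hprod : (∑ k, |Q k|) * ∑ k, |H k| ≤ b * c := mul_le_mul hQ hH hH0 (hQ0.trans hQ)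
  have hap := mul_le_mul_of_nonneg_left hprod ha.le
  have d0 := mul_nonneg (by positivity : 0 ≤ |Q 1| * |H 2| + |Q 2| * |H 1|) (hN' 0)
  have d1 := mul_nonneg (by positivity : 0 ≤ |Q 0| * |H 2| + |Q 2| * |H 0|) (hN' 1)
  have d2 := mul_nonneg (by positivity : 0 ≤ |Q 0| * |H 1| + |Q 1| * |H 0|) (hN' 2)
  have d3 : 0 ≤ a * (|Q 0| * |H 0| + |Q 1| * |H 1| + |Q 2| * |H 2|) := by positivity
  linarith

/-- A moving box of maximal volume always keeps the same edges vertical. -/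
theorem exists_vertical (h : DoorPassage a b c s O ξ η) (ha : 0 < a) (hb : 0 < b) (hc : 0 < c)
    (hV : s 0 * s 1 * s 2 = a * b * c) : ∃ k, s k = c ∧ ∀ t, |O t 2 k| = 1 := by
  obtain ⟨t, ⟨l, hl⟩, hfirst, ht⟩ := h.exists_first_narrow
  have hN := (ht t le_rfl).2
  have hs := h.pos
  have habs : ∀ k v, |s k * v| = s k * |v| := fun k v => by rw [abs_mul, abs_of_pos (hs k)]
  have hO := h.orthogonal
  obtain ⟨hrow, hcol, -⟩ := orthogonal_relations (hO t)
  obtain ⟨hQb, hHc, hcases⟩ := support_of_det_bound ha hb hc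
    (N := fun k => s k * O t 0 k) (Q := fun k => s k * (O t 1 k - l * O t 0 k))
    (H := fun k => s k * O t 2 k) (fun k => by simpa only [habs] using hN k)
    (by simpa only [habs] using hl) (by simpa only [habs] using h.height_le t)
    (by
      rw [← prod_eq_abs_det (hO t) hs l (fun _ => rfl) (fun _ => rfl) (fun _ => rfl)]
      exact hV.ge)
  simp only [habs] at hQb hHc
  rcases hcases with ⟨k, hk⟩ | ⟨i, hHi, hi⟩
  · have hz : ∀ j ≠ k, O t 2 j = 0 := fun j hj =>
      (mul_eq_zero.mp (hk j hj)).resolve_left (hs j).ne'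
    rw [forall_ne_fin_three] at hz
    have h1 : |O t 2 k| = 1 := by
      have := hrow 2
      rw [sum_fin_three_cyclic _ k, hz.1, hz.2, ← sq_abs] at this
      have h0 := abs_nonneg (O t 2 k)
      nlinarith
    have hsk : s k = c := by
      rw [sum_fin_three_cyclic _ k, hz.1, hz.2, h1] at hHc
      simpa using hHc
    exact ⟨k, hsk, fun t' => abs_row_eq_one_of_slab hs h.continuous_orientation hO h.height_le hsk
      h1 t'⟩
  · -- the remaining case is an isolated orientation that no movement attains
    exfalso
    rw [forall_ne_fin_three] at hi
    obtain ⟨⟨hQ1, hH1, hN1⟩, hQ2, hH2, hN2⟩ := hi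
    rw [habs] at hN1 hN2
    have hW := (ht t le_rfl).1
    -- Two edges already contribute `a` each to a width of at most `2 * a`.
    have hni : O t 0 i = 0 := by
      rw [sum_fin_three_cyclic _ i, hN1, hN2] at hW
      have h0 : s i * |O t 0 i| ≤ 0 := by linarith
      have h1 := nonpos_of_mul_nonpos_right h0 (hs i)
      exact abs_nonpos_iff.mp h1
    have hmi : O t 2 i = 0 := (mul_eq_zero.mp hHi).resolve_left (hs i).ne'
    have hpi : |O t 1 i| = 1 := by
      have := hcol i
      rw [Fin.sum_univ_three, hni, hmi, ← sq_abs (O t 1 i)] at this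
      have h0 := abs_nonneg (O t 1 i)
      nlinarith
    have hsi : s i = b := by
      rw [sum_fin_three_cyclic _ i, ← habs (i + 1), ← habs (i + 2), hQ1, hQ2, hni, mul_zero,
        sub_zero, hpi] at hQb
      simpa using hQb
    -- At the start the whole box fits between `0` and `a`, whereas its width here is `2 * a`.
    have ht0 : t ≠ 0 := by
      rintro rfl
      have h1 := h.start_half_width_le
      have h2 := h.half_width_le 0
      rw [sum_fin_three_cyclic _ i, hN1, hN2, hni, abs_zero, mul_zero] at h1 h2
      linarith
    have hκ1 : 0 < s (i + 1) * |O t 2 (i + 1)| := by rw [← habs]; exact abs_pos.mpr hH1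
    have hκ2 : 0 < s (i + 2) * |O t 2 (i + 2)| := by rw [← habs]; exact abs_pos.mpr hH2
    obtain ⟨κ, hκ0, hκ⟩ := exists_between (lt_min hκ1 hκ2)
    rw [lt_min_iff] at hκ
    have hent := h.continuous_entry
    have e1 : ∀ᶠ t' in nhds t, κ < s (i + 1) * |O t' 2 (i + 1)| :=
      ((continuous_const.mul (hent _ _).abs).tendsto t).eventually_const_lt hκ.1
    have e2 : ∀ᶠ t' in nhds t, κ < s (i + 2) * |O t' 2 (i + 2)| :=
      ((continuous_const.mul (hent _ _).abs).tendsto t).eventually_const_lt hκ.2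
    have e3 : ∀ᶠ t' in nhds t, |O t' 2 i| * c < b :=
      (((hent _ _).abs.mul continuous_const).tendsto t).eventually_lt_const (by simpa [hmi] using hb)
    have e4 : ∀ᶠ t' in nhds t, a * c * |O t' 0 i| < b * κ :=
      ((continuous_const.mul (hent _ _).abs).tendsto t).eventually_lt_const (by
        simpa [hni] using mul_pos hb hκ0)
    have : (nhdsWithin t (Iio t)).NeBot :=
      nhdsLT_neBot_of_exists_lt ⟨0, lt_of_le_of_ne bot_le ht0.symm⟩
    obtain ⟨t', ⟨e1, e2, e3, e4⟩, htt'⟩ :=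
      ((((e1.and (e2.and (e3.and e4)))).filter_mono nhdsWithin_le_nhds).and
        self_mem_nhdsWithin).exists (f := nhdsWithin t (Iio t))
    have htt' : t' < t := htt'
    have hp := abs_middle_eq_one_of_near ha hs hsi hV (hO t') (ht t' htt'.le).2 (ht t' htt'.le).1
      (h.height_le t') e1.le e2.le e3 e4
    have hz := row_eq_zero_of_abs_eq_one (hO t') hp
    rw [forall_ne_fin_three] at hz
    -- At the earlier time `t'` the edge of length `b` is still along the second axis, so the box is
    -- narrow with multiplier `0`, against the choice of `t`.
    refine hfirst t' htt' ⟨0, ?_⟩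
    rw [sum_fin_three_cyclic _ i, hz.1, hz.2]
    simp [hp, hsi]

end DoorPassage

/-! ### Boxes and rigid motions in coordinates -/

/-- The open box with side lengths `s` in standard position. -/
def stdBox {n : ℕ} (s : Fin n → ℝ) : Set (Euc n) := {x | ∀ k, 0 < x k ∧ x k < s k}

theorem isOpenBox_iff {n : ℕ} {S : Set (Euc n)} :
    IsOpenBox S ↔ ∃ s : Fin n → ℝ, (∀ k, 0 < s k) ∧ ∃ g : EucGroup n, S = g '' stdBox s :=
  Iff.rfl

theorem volume_stdBox {n : ℕ} {s : Fin n → ℝ} (hs : ∀ k, 0 < s k) :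
    volume (stdBox s) = ENNReal.ofReal (∏ k, s k) := by
  have h : stdBox s = (WithLp.ofLp : Euc n → Fin n → ℝ) ⁻¹' (univ.pi fun k => Ioo 0 (s k)) := by
    ext x
    simp [stdBox]
  rw [h, (PiLp.volume_preserving_ofLp (Fin n)).measure_preimage
    (MeasurableSet.univ_pi fun _ => measurableSet_Ioo).nullMeasurableSet, Real.volume_pi_Ioo,
    ENNReal.ofReal_prod_of_nonneg fun k _ => (hs k).le]
  simp

theorem volume_image_eucGroup {n : ℕ} (g : EucGroup n) (S : Set (Euc n)) :
    volume (g '' S) = volume S := by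
  have h : (g : Euc n → Euc n) = (fun x => x + g 0) ∘ g.linearIsometryEquiv := by
    funext x
    have := g.map_vadd 0 x
    simpa using this
  rw [h, image_comp, image_add_right, measure_preimage_add_right]
  have h2 := g.linearIsometryEquiv.measurePreserving.measure_preimage_equiv
    (f := g.linearIsometryEquiv.toMeasurableEquiv)
    (g.linearIsometryEquiv '' S)
  rw [← h2]
  congr 1
  exact preimage_image_eq S g.linearIsometryEquiv.injective

/-- The matrix of the linear part of a rigid motion. -/
noncomputable def orientation {n : ℕ} (g : EucGroup n) : Matrix (Fin n) (Fin n) ℝ :=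
  Matrix.of fun i k => g.linearIsometryEquiv (EuclideanSpace.single k 1) i

theorem linear_apply_eq_sum {n : ℕ} (g : EucGroup n) (v : Euc n) (i : Fin n) :
    g.linearIsometryEquiv v i = ∑ k, orientation g i k * v k := by
  have h : v = ∑ k, v k • EuclideanSpace.single k (1 : ℝ) := by
    conv_lhs => rw [← (EuclideanSpace.basisFun (Fin n) ℝ).sum_repr v]
    simp
  conv_lhs => rw [h, map_sum]
  simp [orientation, mul_comm]

theorem orientation_mul_transpose {n : ℕ} (g : EucGroup n) :
    orientation g * (orientation g).transpose = 1 := by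
  refine mul_eq_one_comm.mp ?_
  ext k l
  have h := g.linearIsometryEquiv.inner_map_map (EuclideanSpace.single k (1 : ℝ))
    (EuclideanSpace.single l (1 : ℝ))
  rw [PiLp.inner_apply] at h
  simp only [Matrix.mul_apply, Matrix.transpose_apply, orientation, Matrix.of_apply]
  rw [Matrix.one_apply]
  convert h using 1
  · exact Finset.sum_congr rfl fun i _ => by simp [mul_comm]
  · simp [EuclideanSpace.inner_single_left]

/-- The centre of the box of side lengths `s` in standard position. -/
noncomputable def boxCenter {n : ℕ} (s : Fin n → ℝ) : Euc n := WithLp.toLp 2 fun k => s k / 2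

theorem apply_eq_center_add {n : ℕ} (g : EucGroup n) (s : Fin n → ℝ) (x : Euc n) (i : Fin n) :
    g x i = g (boxCenter s) i + ∑ k, orientation g i k * (x k - s k / 2) := by
  have h := g.map_vsub x (boxCenter s)
  have h2 := congrArg (fun v : Euc n => v i) h
  simp only [vsub_eq_sub, PiLp.sub_apply, linear_apply_eq_sum] at h2
  simp only [boxCenter] at h2 ⊢
  linarith

/-- Matrix entries are differences of coordinates of two orbits, so pointwise continuity suffices.
-/
theorem continuous_orientation {X : Type*} [TopologicalSpace X] {n : ℕ} {Φ : X → EucGroup n}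
    (hΦ : ∀ x, Continuous fun t => Φ t x) : Continuous fun t => orientation (Φ t) := by
  refine continuous_matrix fun i k => ?_
  have h : ∀ t, orientation (Φ t) i k = Φ t (EuclideanSpace.single k 1) i - Φ t 0 i := by
    intro t
    have h := (Φ t).map_vsub (EuclideanSpace.single k 1) 0
    have h2 := congrArg (fun v : Euc n => v i) h
    simpa [orientation] using h2
  simp only [h]
  have h1 := hΦ (EuclideanSpace.single k 1)
  have h2 := hΦ 0
  fun_prop

/-- The rigid motion that carries the box of side lengths `s` in standard position to the one with
a given orientation and centre. -/
theorem exists_eucGroup {n : ℕ} {M : Matrix (Fin n) (Fin n) ℝ} (hM : M * M.transpose = 1)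
    (s q : Fin n → ℝ) :
    ∃ g : EucGroup n, ∀ x i, g x i = q i + ∑ k, M i k * (x k - s k / 2) := by
  have hM' : M.transpose * M = 1 := mul_eq_one_comm.mp hM
  let L : Euc n →ₗᵢ[ℝ] Euc n := (Matrix.toEuclideanLin M).isometryOfInner fun x y => by
    simp only [EuclideanSpace.inner_eq_star_dotProduct, Matrix.toLpLin_apply, star_trivial]
    rw [Matrix.dotProduct_mulVec, ← Matrix.mulVec_transpose, Matrix.mulVec_mulVec, hM',
      Matrix.one_mulVec]
  let v : Euc n := WithLp.toLp 2 fun i => q i - ∑ k, M i k * (s k / 2)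
  refine ⟨(L.toLinearIsometryEquiv rfl).toAffineIsometryEquiv.trans
    (AffineIsometryEquiv.constVAdd ℝ (Euc n) v), fun x i => ?_⟩
  have : ((L.toLinearIsometryEquiv rfl).toAffineIsometryEquiv.trans
    (AffineIsometryEquiv.constVAdd ℝ (Euc n) v)) x i = v i + M.mulVec x.ofLp i := rfl
  rw [this]
  simp only [v, Matrix.mulVec, dotProduct, mul_sub, Finset.sum_sub_distrib]
  ring

/-- Absorbs the initial placement of a box into the motion, reducing everything to `stdBox`. -/
theorem IsMovement.comp_right {n : ℕ} {A B S T : Set (Euc n)} {Φ : unitInterval → EucGroup n}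
    (h : IsMovement A B S Φ) {g : EucGroup n} (hS : S = g '' T) :
    IsMovement A B T fun t => g.trans (Φ t) := by
  have himg : ∀ t, (g.trans (Φ t)) '' T = Φ t '' S := fun t => by
    rw [hS, AffineIsometryEquiv.coe_trans, image_comp]
  refine ⟨fun x => h.1 (g x), ?_, ?_, fun t => ?_⟩
  · rw [himg]; exact h.2.1
  · rw [himg]; exact h.2.2.1
  · rw [himg]; exact h.2.2.2 t

/-- The image at any time of a movement can itself be moved. -/
theorem IsMovement.image_mem_movableBoxes {n : ℕ} {A B : Set (Euc n)} {s : Fin n → ℝ}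
    {Φ : unitInterval → EucGroup n} (hs : ∀ k, 0 < s k) (h : IsMovement A B (stdBox s) Φ)
    (t : unitInterval) : Φ t '' stdBox s ∈ movableBoxes A B := by
  refine ⟨⟨s, hs, Φ t, rfl⟩, fun t' => (Φ t).symm.trans (Φ t'), h.comp_right ?_⟩
  rw [← image_comp, ← AffineIsometryEquiv.coe_trans]
  simp

/-! ### Arms, cylinders, and the upper bounds for area and volume -/

theorem armA_subset (a b : ℝ) (i : Fin 2) {p : Euc 2} (hp : p ∈ armA a b i) (ha : 0 < a) :
    0 < p 0 ∧ p 0 ≤ a ∧ (p 0 = a → 0 < p 1 ∧ p 1 < b) := by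
  have h : p ∈ door a b ∪ {p : Euc 2 | 0 < p 0 ∧ p 0 < a} := by
    match i, hp with
    | 0, hp => exact hp
    | 1, hp => exact hp.1
  rcases h with h | h
  · exact ⟨h.1 ▸ ha, h.1.le, fun _ => h.2⟩
  · exact ⟨h.1, h.2.le, fun h' => absurd h' h.2.ne⟩

theorem armB_subset (a b : ℝ) (j : Fin 4) {p : Euc 2} (hp : p ∈ armB a b j) :
    a ≤ p 0 ∧ (p 0 = a → 0 < p 1 ∧ p 1 < b) := by
  have h : p ∈ door a b ∪ {p : Euc 2 | a < p 0} := by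
    match j, hp with
    | 0, hp => exact hp
    | 1, hp => exact hp.1
    | 2, hp => exact hp.1
    | 3, hp => exact hp.1
  rcases h with h | h
  · exact ⟨h.1.ge, fun _ => h.2⟩
  · exact ⟨le_of_lt h, fun h' => absurd h' (ne_of_gt h)⟩

theorem mem_cyl {S : Set (Euc 2)} {c : ℝ} {p : Euc 3} :
    p ∈ cyl S c ↔ !₂[p 0, p 1] ∈ S ∧ 0 < p 2 ∧ p 2 < c := Iff.rfl

/-- Every point of the base lifts to height `c / 2`. -/
theorem subset_of_cyl_subset_cyl {S T : Set (Euc 2)} {c : ℝ} (hc : 0 < c)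
    (h : cyl S c ⊆ cyl T c) : S ⊆ T := by
  intro p hp
  have h1 : ∀ p : Euc 2, !₂[p 0, p 1] = p := fun p => by ext i; fin_cases i <;> rfl
  have h2 : !₂[p 0, p 1, c / 2] ∈ cyl S c := by
    refine ⟨?_, half_pos hc, half_lt_self hc⟩
    change !₂[p 0, p 1] ∈ S
    rwa [h1]
  have h3 : !₂[p 0, p 1] ∈ T := (h h2).1
  rwa [h1] at h3

theorem cyl_union (S T : Set (Euc 2)) (c : ℝ) : cyl (S ∪ T) c = cyl S c ∪ cyl T c := by
  ext p
  simp only [mem_cyl, mem_union]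
  tauto

theorem boxCenter_add_mem_stdBox {n : ℕ} {s x : Fin n → ℝ} (hx : ∀ k, |x k| < s k / 2) :
    WithLp.toLp 2 (fun k => s k / 2 + x k) ∈ stdBox s := fun k => by
  have := abs_lt.mp (hx k)
  constructor <;> simp only <;> linarith

theorem boxCenter_mem_stdBox {n : ℕ} {s : Fin n → ℝ} (hs : ∀ k, 0 < s k) :
    boxCenter s ∈ stdBox s := fun k => ⟨half_pos (hs k), half_lt_self (hs k)⟩

theorem apply_boxCenter_add {n : ℕ} (g : EucGroup n) (s x : Fin n → ℝ) (i : Fin n) :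
    g (WithLp.toLp 2 fun k => s k / 2 + x k) i
      = g (boxCenter s) i + ∑ k, orientation g i k * x k := by
  rw [apply_eq_center_add g s]
  simp

theorem height_le_of_image_subset {g : EucGroup 3} {s : Fin 3 → ℝ} (hs : ∀ k, 0 < s k)
    {S : Set (Euc 2)} {c : ℝ} (h : g '' stdBox s ⊆ cyl S c) :
    (∑ k, s k * |orientation g 2 k|) / 2 ≤ g (boxCenter s) 2 ∧
      (∑ k, s k * |orientation g 2 k|) / 2 ≤ c - g (boxCenter s) 2 := by
  have hx : ∀ x : Fin 3 → ℝ, (∀ k, |x k| < s k / 2) →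
      0 < g (boxCenter s) 2 + ∑ k, orientation g 2 k * x k ∧
        g (boxCenter s) 2 + ∑ k, orientation g 2 k * x k < c := by
    intro x hx
    rw [← apply_boxCenter_add]
    exact (h (mem_image_of_mem g (boxCenter_add_mem_stdBox hx))).2
  have h1 := half_sum_le_of_forall_box hs fun x h' => (hx x h').1.le
  have h2 := add_half_sum_le_of_forall_box hs fun x h' => (hx x h').2.le
  constructor <;> linarith

theorem mem_arms {a b : ℝ} {i : Fin 2} {j : Fin 4} (ha : 0 < a) {p : Euc 2}
    (hp : p ∈ armA a b i ∪ armB a b j) : 0 < p 0 ∧ (p 0 = a → 0 < p 1 ∧ p 1 < b) := by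
  rcases hp with h | h
  · have := armA_subset a b i h ha
    exact ⟨this.1, this.2.2⟩
  · have := armB_subset a b j h
    exact ⟨ha.trans_le this.1, this.2⟩

theorem doorPassage_of_movement {a b c : ℝ} (ha : 0 < a) {i : Fin 2} {j : Fin 4} {s : Fin 3 → ℝ}
    (hs : ∀ k, 0 < s k) {Φ : unitInterval → EucGroup 3}
    (h : IsMovement (cyl (armA a b i) c) (cyl (armB a b j) c) (stdBox s) Φ) :
    DoorPassage a b c s (fun t => orientation (Φ t)) (fun t => Φ t (boxCenter s) 0)
      fun t => Φ t (boxCenter s) 1 where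
  pos := hs
  continuous_orientation := continuous_orientation h.1
  continuous_center := by
    have := h.1 (boxCenter s)
    fun_prop
  orthogonal t := orientation_mul_transpose (Φ t)
  nonneg t x hx := by
    rw [← apply_boxCenter_add]
    have := h.2.2.2 t (mem_image_of_mem _ (boxCenter_add_mem_stdBox hx))
    rw [← cyl_union] at this
    exact (mem_arms ha this.1).1.le
  start_le x hx := by
    rw [← apply_boxCenter_add]
    exact (armA_subset a b i (h.2.1 (mem_image_of_mem _ (boxCenter_add_mem_stdBox hx))).1 ha).2.1
  le_end := (armB_subset a b j (h.2.2.1 (mem_image_of_mem _ (boxCenter_mem_stdBox hs))).1).1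
  door t x hx := by
    rw [← apply_boxCenter_add, ← apply_boxCenter_add]
    have := h.2.2.2 t (mem_image_of_mem _ (boxCenter_add_mem_stdBox hx))
    rw [← cyl_union] at this
    exact (mem_arms ha this.1).2
  height_le t := by
    have h1 : Φ t '' stdBox s ⊆ cyl (armA a b i ∪ armB a b j) c := by
      rw [cyl_union]; exact h.2.2.2 t
    have := height_le_of_image_subset hs h1
    linarith [this.1, this.2]

/-- A rotation of the plane, acting on the first two coordinates of space. -/
def planeOrientation (M : Matrix (Fin 2) (Fin 2) ℝ) : Matrix (Fin 3) (Fin 3) ℝ :=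
  !![M 0 0, M 0 1, 0; M 1 0, M 1 1, 0; 0, 0, 1]

theorem planeOrientation_mul_transpose {M : Matrix (Fin 2) (Fin 2) ℝ} (hM : M * M.transpose = 1) :
    planeOrientation M * (planeOrientation M).transpose = 1 := by
  have h : ∀ i j, M i 0 * M j 0 + M i 1 * M j 1 = if i = j then 1 else 0 := fun i j => by
    have := congrFun (congrFun hM i) j
    simpa [Matrix.mul_apply, Fin.sum_univ_two, Matrix.one_apply] using this
  have h00 := h 0 0
  have h01 := h 0 1
  have h10 := h 1 0
  have h11 := h 1 1
  ext i j
  fin_cases i <;> fin_cases j <;>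
    simp_all [planeOrientation, Matrix.mul_apply, Fin.sum_univ_three]

/-- A moving rectangle is treated as an upright prism of height `c`, so that the area bound follows
from the volume bound. -/
theorem doorPassage_of_plane_movement {a b c : ℝ} (ha : 0 < a) (hc : 0 < c) {i : Fin 2} {j : Fin 4}
    {s : Fin 2 → ℝ} (hs : ∀ k, 0 < s k) {Φ : unitInterval → EucGroup 2}
    (h : IsMovement (armA a b i) (armB a b j) (stdBox s) Φ) :
    DoorPassage a b c ![s 0, s 1, c] (fun t => planeOrientation (orientation (Φ t)))
      (fun t => Φ t (boxCenter s) 0) fun t => Φ t (boxCenter s) 1 := by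
  have hbox : ∀ x : Fin 3 → ℝ, (∀ k, |x k| < ![s 0, s 1, c] k / 2) →
      ∀ k : Fin 2, |![x 0, x 1] k| < s k / 2 := by
    intro x hx k
    fin_cases k
    · exact hx 0
    · exact hx 1
  have hsum0 : ∀ t (x : Fin 3 → ℝ), ∑ k, planeOrientation (orientation (Φ t)) 0 k * x k =
      ∑ k, orientation (Φ t) 0 k * ![x 0, x 1] k := by
    intro t x
    simp [Fin.sum_univ_three, planeOrientation]
  have hsum1 : ∀ t (x : Fin 3 → ℝ), ∑ k, planeOrientation (orientation (Φ t)) 1 k * x k =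
      ∑ k, orientation (Φ t) 1 k * ![x 0, x 1] k := by
    intro t x
    simp [Fin.sum_univ_three, planeOrientation]
  have hcont := continuous_orientation h.1
  refine ⟨?_, ?_, ?_, fun t => planeOrientation_mul_transpose (orientation_mul_transpose _),
    fun t x hx => ?_, fun x hx => ?_, ?_, fun t x hx => ?_, fun t => ?_⟩
  · intro k
    fin_cases k
    · exact hs 0
    · exact hs 1
    · exact hc
  · refine continuous_matrix fun i k => ?_
    fin_cases i <;> fin_cases k <;> simp only [planeOrientation] <;> simp <;> fun_prop
  · have := h.1 (boxCenter s)
    fun_prop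
  · rw [hsum0, ← apply_boxCenter_add]
    exact (mem_arms ha (h.2.2.2 t (mem_image_of_mem _ (boxCenter_add_mem_stdBox (hbox x hx))))).1.le
  · rw [hsum0, ← apply_boxCenter_add]
    exact (armA_subset a b i
      (h.2.1 (mem_image_of_mem _ (boxCenter_add_mem_stdBox (hbox x hx)))) ha).2.1
  · exact (armB_subset a b j (h.2.2.1 (mem_image_of_mem _ (boxCenter_mem_stdBox hs)))).1
  · rw [hsum0, hsum1, ← apply_boxCenter_add, ← apply_boxCenter_add]
    exact (mem_arms ha (h.2.2.2 t (mem_image_of_mem _ (boxCenter_add_mem_stdBox (hbox x hx))))).2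
  · simp [Fin.sum_univ_three, planeOrientation]

theorem volume_le_of_mem_movableRectangles {a b : ℝ} (ha : 0 < a) {i : Fin 2} {j : Fin 4}
    {R : Set (Euc 2)} (hR : R ∈ movableRectangles a b i j) :
    volume R ≤ ENNReal.ofReal (a * b) := by
  obtain ⟨⟨s, hs, g, hRg⟩, Φ, hΦ⟩ := hR
  have h := (doorPassage_of_plane_movement (c := 1) ha one_pos hs (hΦ.comp_right hRg)).volume_le ha
  rw [hRg, volume_image_eucGroup]
  change volume (stdBox s) ≤ _
  rw [volume_stdBox hs, Fin.prod_univ_two]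
  exact ENNReal.ofReal_le_ofReal (by simpa using h)

theorem volume_le_of_mem_movableBoxes {a b c : ℝ} (ha : 0 < a) {i : Fin 2} {j : Fin 4}
    {P : Set (Euc 3)} (hP : P ∈ movableBoxes (cyl (armA a b i) c) (cyl (armB a b j) c)) :
    volume P ≤ ENNReal.ofReal (a * b * c) := by
  obtain ⟨⟨s, hs, g, hPg⟩, Φ, hΦ⟩ := hP
  have h := (doorPassage_of_movement ha hs (hΦ.comp_right hPg)).volume_le ha
  rw [hPg, volume_image_eucGroup]
  change volume (stdBox s) ≤ _
  rw [volume_stdBox hs, Fin.prod_univ_three]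
  exact ENNReal.ofReal_le_ofReal h

/-! ### Attainment, and reduction of extremal motions to the plane -/

/-- Rectangles with a horizontal side move around the corner by a translation. -/
theorem mem_arms_of_translation {a b : ℝ} (i : Fin 2) (j : Fin 4) {x r y : ℝ}
    (hx : 0 < x ∧ x < a) (hy : 0 < y ∧ y < b) (hr : 0 ≤ r) :
    (r = 0 → !₂[x + r, y] ∈ armA a b i) ∧ (r = a → !₂[x + r, y] ∈ armB a b j) ∧
      !₂[x + r, y] ∈ armA a b i ∪ armB a b j := by
  have hA : x + r ≤ a → !₂[x + r, y] ∈ armA a b i := by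
    intro h
    have h0 : !₂[x + r, y] ∈ door a b ∪ {p : Euc 2 | 0 < p 0 ∧ p 0 < a} := by
      rcases h.eq_or_lt with h | h
      · exact Or.inl ⟨h, hy⟩
      · exact Or.inr ⟨by simpa using add_pos_of_pos_of_nonneg hx.1 hr, h⟩
    match i with
    | 0 => exact h0
    | 1 => exact ⟨h0, hy.1⟩
  have hB : a ≤ x + r → !₂[x + r, y] ∈ armB a b j := by
    intro h
    have h0 : !₂[x + r, y] ∈ door a b ∪ {p : Euc 2 | a < p 0} := by
      rcases h.eq_or_lt with h | h
      · exact Or.inl ⟨h.symm, hy⟩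
      · exact Or.inr h
    match j with
    | 0 => exact h0
    | 1 => exact ⟨h0, hy.1⟩
    | 2 => exact ⟨h0, hy.2⟩
    | 3 => exact ⟨h0, hy⟩
  refine ⟨fun h => hA (by linarith), fun h => hB (by linarith), ?_⟩
  rcases le_total (x + r) a with h | h
  · exact Or.inl (hA h)
  · exact Or.inr (hB h)

theorem exists_movement_of_stdBox {a b c : ℝ} (ha : 0 < a) (i : Fin 2) (j : Fin 4) :
    ∃ Φ : unitInterval → EucGroup 3,
      IsMovement (cyl (armA a b i) c) (cyl (armB a b j) c) (stdBox ![a, b, c]) Φ := by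
  refine ⟨fun t => AffineIsometryEquiv.constVAdd ℝ (Euc 3) !₂[t * a, 0, 0], ?_, ?_, ?_, ?_⟩
  · intro x
    change Continuous fun t : unitInterval => (!₂[(t : ℝ) * a, 0, 0] : Euc 3) + x
    fun_prop
  all_goals
    have key : ∀ t : unitInterval, ∀ x : Euc 3, x ∈ stdBox ![a, b, c] →
        (t = 0 → !₂[(t : ℝ) * a, 0, 0] + x ∈ cyl (armA a b i) c) ∧
        (t = 1 → !₂[(t : ℝ) * a, 0, 0] + x ∈ cyl (armB a b j) c) ∧
        !₂[(t : ℝ) * a, 0, 0] + x ∈ cyl (armA a b i) c ∪ cyl (armB a b j) c := by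
      intro t x hx
      have hx0 : 0 < x 0 ∧ x 0 < a := hx 0
      have hx1 : 0 < x 1 ∧ x 1 < b := hx 1
      have hx2 : 0 < x 2 ∧ x 2 < c := hx 2
      have h := mem_arms_of_translation i j hx0 hx1 (mul_nonneg t.2.1 ha.le)
      rw [← cyl_union]
      simp only [mem_cyl, PiLp.add_apply]
      simp only [Matrix.cons_val_zero, Matrix.cons_val_one, Matrix.cons_val, zero_add]
      rw [add_comm]
      exact ⟨fun ht => ⟨h.1 (by simp [ht]), hx2⟩, fun ht => ⟨h.2.1 (by simp [ht]), hx2⟩,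
        h.2.2, hx2⟩
  · rintro _ ⟨x, hx, rfl⟩
    exact (key 0 x hx).1 rfl
  · rintro _ ⟨x, hx, rfl⟩
    exact (key 1 x hx).2.1 rfl
  · rintro t _ ⟨x, hx, rfl⟩
    exact (key t x hx).2.2

/-- A box with vertical edges whose height fills a slab is a cylinder over a rectangle. -/
theorem exists_plane_motion {c : ℝ} {s : Fin 3 → ℝ} (hs : ∀ k, 0 < s k) {k : Fin 3} (hk : s k = c)
    {g : EucGroup 3} (hvert : |orientation g 2 k| = 1) {S : Set (Euc 2)}
    (hg : g '' stdBox s ⊆ cyl S c) :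
    ∃ f : EucGroup 2, (∀ x r, f x r = g (boxCenter s) r.castSucc
        + ∑ l : Fin 2, orientation g r.castSucc (![k + 1, k + 2] l)
          * (x l - s (![k + 1, k + 2] l) / 2)) ∧
      g '' stdBox s = cyl (f '' stdBox ![s (k + 1), s (k + 2)]) c := by
  set O := orientation g with hOdef
  have hO : O * O.transpose = 1 := orientation_mul_transpose g
  obtain ⟨hrow, hcol, horth⟩ := orthogonal_relations hO
  have hz := row_eq_zero_of_abs_eq_one hO hvert
  rw [forall_ne_fin_three] at hz
  have hsq : O 2 k * O 2 k = 1 := by rw [← abs_mul_abs_self, hvert, one_mul]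
  -- The entry in row `2` exhausts the unit column `k`; the complementary `2 × 2` block is therefore
  -- orthogonal.
  have hk0 : O 0 k = 0 ∧ O 1 k = 0 := by
    have := hcol k
    rw [Fin.sum_univ_three] at this
    constructor <;> exact pow_eq_zero_iff two_ne_zero |>.mp (by nlinarith)
  have hM : (Matrix.of fun r l : Fin 2 => O r.castSucc (![k + 1, k + 2] l))
      * (Matrix.of fun r l : Fin 2 => O r.castSucc (![k + 1, k + 2] l)).transpose = 1 := by
    have h0 := hrow 0
    have h1 := hrow 1
    have h01 := horth 0 1 (by decide)
    rw [sum_fin_three_cyclic _ k, hk0.1] at h0 h01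
    rw [sum_fin_three_cyclic _ k, hk0.2] at h1
    ext r r'
    rw [Matrix.mul_apply, Fin.sum_univ_two, Matrix.one_apply]
    fin_cases r <;> fin_cases r' <;> simp <;> linarith
  obtain ⟨f, hf⟩ := exists_eucGroup hM ![s (k + 1), s (k + 2)]
    fun r => g (boxCenter s) r.castSucc
  have hf' : ∀ x r, f x r = g (boxCenter s) r.castSucc
        + ∑ l : Fin 2, O r.castSucc (![k + 1, k + 2] l) * (x l - s (![k + 1, k + 2] l) / 2) := by
    intro x r
    rw [hf]
    simp [Fin.sum_univ_two]
  refine ⟨f, hf', ?_⟩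
  -- A box of height `c` in a slab of height `c` has no vertical freedom.
  have hcen : g (boxCenter s) 2 = c / 2 := by
    have h := height_le_of_image_subset hs hg
    rw [← hOdef, sum_fin_three_cyclic _ k, hz.1, hz.2, hvert, hk] at h
    simp only [abs_zero, mul_zero, add_zero, mul_one] at h
    linarith [h.1, h.2]
  have hg0 : ∀ x : Euc 3, g x 0 = g (boxCenter s) 0 + (O 0 (k + 1) * (x (k + 1) - s (k + 1) / 2)
      + O 0 (k + 2) * (x (k + 2) - s (k + 2) / 2)) := fun x => by
    rw [apply_eq_center_add g s x, sum_fin_three_cyclic _ k, ← hOdef, hk0.1]; ring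
  have hg1 : ∀ x : Euc 3, g x 1 = g (boxCenter s) 1 + (O 1 (k + 1) * (x (k + 1) - s (k + 1) / 2)
      + O 1 (k + 2) * (x (k + 2) - s (k + 2) / 2)) := fun x => by
    rw [apply_eq_center_add g s x, sum_fin_three_cyclic _ k, ← hOdef, hk0.2]; ring
  have hg2 : ∀ x : Euc 3, g x 2 = c / 2 + O 2 k * (x k - c / 2) := fun x => by
    rw [apply_eq_center_add g s x, sum_fin_three_cyclic _ k, ← hOdef, hz.1, hz.2, hcen, hk]; ring
  have hf0 : ∀ x : Euc 2, f x 0 = g (boxCenter s) 0 + (O 0 (k + 1) * (x 0 - s (k + 1) / 2)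
      + O 0 (k + 2) * (x 1 - s (k + 2) / 2)) := fun x => by
    rw [hf', Fin.sum_univ_two]; rfl
  have hf1 : ∀ x : Euc 2, f x 1 = g (boxCenter s) 1 + (O 1 (k + 1) * (x 0 - s (k + 1) / 2)
      + O 1 (k + 2) * (x 1 - s (k + 2) / 2)) := fun x => by
    rw [hf', Fin.sum_univ_two]; rfl
  have hlift : ∀ z : ℝ, 0 < z → z < c → 0 < c / 2 + O 2 k * (z - c / 2) ∧
      c / 2 + O 2 k * (z - c / 2) < c := by
    intro z h0 h1
    have h2 : |O 2 k * (z - c / 2)| < c / 2 := by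
      rw [abs_mul, hvert, one_mul, abs_lt]
      constructor <;> linarith
    have h3 := abs_lt.mp h2
    constructor <;> linarith [h3.1, h3.2]
  ext p
  constructor
  · rintro ⟨x, hx, rfl⟩
    refine ⟨⟨!₂[x (k + 1), x (k + 2)], ?_, ?_⟩, ?_⟩
    · intro l
      fin_cases l
      · exact hx (k + 1)
      · exact hx (k + 2)
    · ext r
      fin_cases r
      · exact (hf0 _).trans (hg0 x).symm
      · exact (hf1 _).trans (hg1 x).symm
    · rw [hg2]
      have := hx k
      rw [hk] at this
      exact hlift _ this.1 this.2
  · rintro ⟨⟨y, hy, hyp⟩, hp2⟩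
    obtain ⟨x, hxk, hx1, hx2⟩ : ∃ x : Euc 3, x k = c / 2 + O 2 k * (p 2 - c / 2) ∧
        x (k + 1) = y 0 ∧ x (k + 2) = y 1 := by
      -- As `O 2 k` is `1` or `-1`, the map on the vertical coordinate is its own inverse.
      refine ⟨WithLp.toLp 2 fun j => if j = k then c / 2 + O 2 k * (p 2 - c / 2) else
        if j = k + 1 then y 0 else y 1, ?_, ?_, ?_⟩
      · simp
      · simp
      · simp
    have hy0 : 0 < y 0 ∧ y 0 < s (k + 1) := hy 0
    have hy1 : 0 < y 1 ∧ y 1 < s (k + 2) := hy 1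
    refine ⟨x, fun j => ?_, ?_⟩
    · by_cases hj : j = k
      · rw [hj, hxk, hk]
        exact hlift _ hp2.1 hp2.2
      · revert j
        rw [forall_ne_fin_three, hx1, hx2]
        exact ⟨hy0, hy1⟩
    · have e0 : f y 0 = p 0 := congrArg (fun v : Euc 2 => v 0) hyp
      have e1 : f y 1 = p 1 := congrArg (fun v : Euc 2 => v 1) hyp
      ext r
      fin_cases r
      · change g x 0 = p 0
        rw [hg0, hx1, hx2, ← hf0, e0]
      · change g x 1 = p 1
        rw [hg1, hx1, hx2, ← hf1, e1]
      · change g x 2 = p 2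
        rw [hg2, hxk]
        linear_combination (p 2 - c / 2) * hsq

theorem image_eq_cyl_of_volume_eq {a b c : ℝ} (ha : 0 < a) (hb : 0 < b) (hc : 0 < c) {i : Fin 2}
    {j : Fin 4} {s : Fin 3 → ℝ} (hs : ∀ k, 0 < s k) (hV : s 0 * s 1 * s 2 = a * b * c)
    {Φ : unitInterval → EucGroup 3}
    (h : IsMovement (cyl (armA a b i) c) (cyl (armB a b j) c) (stdBox s) Φ) (t : unitInterval) :
    ∃ R ∈ maxVolume (movableRectangles a b i j), Φ t '' stdBox s = cyl R c := by
  obtain ⟨k, hk, hvert⟩ := (doorPassage_of_movement ha hs h).exists_vertical ha hb hc hV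
  have hsub : ∀ t, Φ t '' stdBox s ⊆ cyl (armA a b i ∪ armB a b j) c := fun t => by
    rw [cyl_union]; exact h.2.2.2 t
  -- The index `k` is the same at all times, and the explicit formula `hf` makes the motions
  -- continuous in `t` although they are chosen separately.
  choose f hf himg using fun t => exists_plane_motion hs hk (hvert t) (hsub t)
  have hs2 : ∀ l, 0 < ![s (k + 1), s (k + 2)] l := by
    intro l
    fin_cases l
    · exact hs (k + 1)
    · exact hs (k + 2)
  have hmove : IsMovement (armA a b i) (armB a b j) (stdBox ![s (k + 1), s (k + 2)]) f := by
    refine ⟨fun x => ?_, subset_of_cyl_subset_cyl hc ?_, subset_of_cyl_subset_cyl hc ?_,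
      fun t => subset_of_cyl_subset_cyl hc ?_⟩
    · have hO := continuous_orientation h.1
      have hcen := h.1 (boxCenter s)
      refine (PiLp.continuous_toLp 2 _).comp (continuous_pi fun r => ?_ :
        Continuous fun t => (f t x).ofLp)
      simp only [hf]
      fun_prop
    · rw [← himg]; exact h.2.1
    · rw [← himg]; exact h.2.2.1
    · rw [← himg]; exact hsub t
  refine ⟨_, ⟨hmove.image_mem_movableBoxes hs2 t, fun T hT => ?_⟩, himg t⟩
  -- Dividing the volume by the height `s k = c` gives base area `a * b`, which is the upper bound
  -- for movable rectangles.
  refine (volume_le_of_mem_movableRectangles ha hT).trans_eq ?_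
  rw [volume_image_eucGroup, volume_stdBox hs2, Fin.prod_univ_two]
  congr 1
  rw [prod_fin_three_cyclic s k, hk] at hV
  refine mul_right_cancel₀ hc.ne' ?_
  change a * b * c = s (k + 1) * s (k + 2) * c
  linarith

theorem theorem2 (a b c : ℝ) (ha : 0 < a) (hb : 0 < b) (hc : 0 < c) (i : Fin 2) (j : Fin 4) :
    (maxParallelepipeds a b c i j).Nonempty ∧
      ∀ P ∈ maxParallelepipeds a b c i j,
        volume P = ENNReal.ofReal (a * b * c) ∧
          ∀ Φ : unitInterval → EucGroup 3,
            IsMovement (cyl (armA a b i) c) (cyl (armB a b j) c) P Φ →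
              ∀ t : unitInterval,
                ∃ R ∈ maxVolume (movableRectangles a b i j), Φ t '' P = cyl R c := by
  have hpos : ∀ k, 0 < ![a, b, c] k := by
    intro k
    fin_cases k
    · exact ha
    · exact hb
    · exact hc
  have hvol : volume (stdBox ![a, b, c]) = ENNReal.ofReal (a * b * c) := by
    rw [volume_stdBox hpos, Fin.prod_univ_three]
    rfl
  have hmem : stdBox ![a, b, c] ∈ movableBoxes (cyl (armA a b i) c) (cyl (armB a b j) c) :=
    ⟨⟨_, hpos, AffineIsometryEquiv.refl ℝ (Euc 3), (image_id _).symm⟩,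
      exists_movement_of_stdBox ha i j⟩
  refine ⟨⟨_, hmem, fun T hT => hvol ▸ volume_le_of_mem_movableBoxes ha hT⟩, fun P hP => ?_⟩
  have hPvol : volume P = ENNReal.ofReal (a * b * c) :=
    le_antisymm (volume_le_of_mem_movableBoxes ha hP.1) (hvol ▸ hP.2 _ hmem)
  refine ⟨hPvol, fun Φ hΦ t => ?_⟩
  obtain ⟨s, hs, g, hPg⟩ := isOpenBox_iff.mp hP.1.1
  have hV : s 0 * s 1 * s 2 = a * b * c := by
    rw [hPg, volume_image_eucGroup, volume_stdBox hs, Fin.prod_univ_three] at hPvol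
    exact (ENNReal.ofReal_eq_ofReal_iff (mul_pos (mul_pos (hs 0) (hs 1)) (hs 2)).le
      (mul_pos (mul_pos ha hb) hc).le).mp hPvol
  obtain ⟨R, hR, hRt⟩ := image_eq_cyl_of_volume_eq ha hb hc hs hV (hΦ.comp_right hPg) t
  refine ⟨R, hR, ?_⟩
  rw [← hRt, hPg, AffineIsometryEquiv.coe_trans, image_comp]
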